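/- Fix $\hbar\in\mathbb C$, put $q^x=e^{\hbar x}$ and assume $q\neq q^{-1}$; let $[x]_q=\frac{q^x-q^{-x}}{q-q^{-1}}$. Let $\alpha,k\in\mathbb C\setminus\{0,-1\}$, and let $(a_{ij})_{i,j=1,2}=\begin{pmatrix}2&-1\\-1&0\end{pmatrix}$. **The algebra.** $U_q[\widehat{sl(2|1)}]$ is the $\mathbb Z_2$-graded algebra with Drinfeld generators $X^{\pm,i}_m$, $h^i_n$, $q^{\pm h^i_0}$, $q^{\pm c/2}$, $d$ ($i=1,2$; $m\in\mathbb Z$; $n\in\mathbb Z\setminus\{0\}$), where $X^{\pm,2}_m$ are odd and all other generators are even, $c$ is central, the $h^i_0$ commute with each other, with $h^j_m$ and with $d$, $[d,h^j_m]=mh^j_m$, $[d,X^{\pm,j}_m]=mX^{\pm,j}_m$, and, with $[X,Y]_\xi=XY-(-1)^{[X][Y]}\xi YX$ and $[X,Y]=[X,Y]_1$, $$[h^i_m,h^j_n]=\delta_{m+n,0}\tfrac{[a_{ij}m]_q[mc]_q}{m},\quad q^{h^i_0}X^{\pm,j}_mq^{-h^i_0}=q^{\pm a_{ij}}X^{\pm,j}_m,\quad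 [h^i_m,X^{\pm,j}_n]=\pm\tfrac{[a_{ij}m]_q}{m}q^{\mp|m|c/2}X^{\pm,j}_{n+m},$$ $$[X^{+,i}_m,X^{-,j}_n]=\tfrac{\delta_{ij}}{q-q^{-1}}\bigl(q^{(m-n)c/2}\psi^{+,j}_{m+n}-q^{-(m-n)c/2}\psi^{-,j}_{m+n}\bigr),\quad [X^{\pm,2}_m,X^{\pm,2}_n]=0,$$ $$[X^{\pm,i}_{m+1},X^{\pm,j}_n]_{q^{\pm a_{ij}}}+[X^{\pm,j}_{n+1},X^{\pm,i}_m]_{q^{\pm a_{ij}}}=0\ (a_{ij}\ne0),\quad [X^{\pm,1}_{n_1},[X^{\pm,1}_{n_2},X^{\pm,2}_m]_{q^{-1}}]_q+(n_1\leftrightarrow n_2)=0,$$ where $\sum_n\psi^{\pm,i}_nz^{-n}=q^{\pm h^i_0}\exp\bigl(\pm(q-q^{-1})\sum_{n>0}h^i_{\pm n}z^{\mp n}\bigr)$. The Chevalley generators are $h_i=h^i_0$, $e_i=X^{+,i}_0$, $f_i=X^{-,i}_0$ ($i=1,2$), $h_0=c-h^1_0-h^2_0$, $e_0=-[X^{-,2}_0,X^{-,1}_1]_{q^{-1}}q^{-h^1_0-h^2_0}$,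 $f_0=q^{h^1_0+h^2_0}[X^{+,1}_{-1},X^{+,2}_0]_q$. The coproduct is $\Delta(e_i)=e_i\otimes1+q^{h_i}\otimes e_i$, $\Delta(f_i)=f_i\otimes q^{-h_i}+1\otimes f_i$, $\Delta(q^{h_i})=q^{h_i}\otimes q^{h_i}$, and tensor products carry the sign rule $(a\otimes b)(u\otimes v)=(-1)^{[b][u]}au\otimes bv$. **The evaluation modules.** Choose square roots $\sqrt{[\alpha]_q}$, $\sqrt{[\alpha+1]_q}$. $V_{\alpha,z}$ has the basis $v_1,\dots,v_4$ ($v_1,v_4$ even, $v_2,v_3$ odd) with matrix units $e_{ij}$, and $e_1=e_{23}$, $f_1=e_{32}$, $h_1=e_{22}-e_{33}$, $e_2=\sqrt{[\alpha]_q}e_{12}+\sqrt{[\alpha+1]_q}e_{34}$, $f_2=\sqrt{[\alpha]_q}e_{21}+\sqrt{[\alpha+1]_q}e_{43}$, $h_2=\alpha(e_{11}+e_{22})+(\alpha+1)(e_{33}+e_{44})$, $e_0=-z(-\sqrt{[\alpha]_q}e_{31}+\sqrt{[\alpha+1]_q}e_{42})$, $f_0=z^{-1}(-\sqrt{[\alpha]_q}e_{13}+\sqrt{[\alpha+1]_q}e_{24})$,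 $h_0=-h_1-h_2$. The dual module $V^{*S}_{\alpha,z}$ has the basis $v_1^*,\dots,v_4^*$ with the same parities, and $e_1=-q^{-1}e_{32}$, $f_1=-qe_{23}$, $h_1=-e_{22}+e_{33}$, $e_2=q^{-\alpha}\sqrt{[\alpha]_q}e_{21}-q^{-\alpha-1}\sqrt{[\alpha+1]_q}e_{43}$, $f_2=-q^{\alpha}\sqrt{[\alpha]_q}e_{12}+q^{\alpha+1}\sqrt{[\alpha+1]_q}e_{34}$, $h_2=-\alpha(e_{11}+e_{22})-(\alpha+1)(e_{33}+e_{44})$, $e_0=-z(q^{\alpha}\sqrt{[\alpha]_q}e_{13}+q^{\alpha+1}\sqrt{[\alpha+1]_q}e_{24})$, $f_0=-z^{-1}(q^{-\alpha}\sqrt{[\alpha]_q}e_{31}+q^{-\alpha-1}\sqrt{[\alpha+1]_q}e_{42})$, $h_0=-h_1-h_2$. **The vertex operators.** Let $M,N$ be $\mathbb Z_2$-graded $U_q[\widehat{sl(2|1)}]$-modules of level $k$ (that is, $q^{\pm c/2}$ acts as $q^{\pm k/2}$), for example highest weight modules $V(\lambda),V(\mu)$. Let $$\Phi(z):M\to N\otimes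 V_{\alpha,z},\quad \Phi^*(z):M\to N\otimes V^{*S}_{\alpha,z},\quad \Psi(z):M\to V_{\alpha,z}\otimes N,\quad \Psi^*(z):M\to V^{*S}_{\alpha,z}\otimes N$$ be even formal series in $z^{\pm1}$ which satisfy $\Theta(z)x=\Delta(x)\Theta(z)$ for $x=e_i,f_i,q^{\pm h_i}$, $i=0,1,2$. Write $\Phi(z)=\sum_r\Phi_r(z)\otimes v_r$, $\Phi^*(z)=\sum_r\Phi^*_r(z)\otimes v^*_r$, $\Psi(z)=\sum_rv_r\otimes\Psi_r(z)$, $\Psi^*(z)=\sum_rv^*_r\otimes\Psi^*_r(z)$, and $X^{\pm,i}(w)=\sum_mX^{\pm,i}_mw^{-m-1}$. **Proposition.** For $i=1,2$ and all integers $n>0$: 1. $[\Phi_4(z),X^{+,i}(w)]=0$, $\;q^{h^i_0}\Phi_4(z)q^{-h^i_0}=q^{-(\alpha+1)\delta_{i2}}\Phi_4(z)$, $[h^i_n,\Phi_4(z)]=-\delta_{i2}q^{(1+\frac32k)n}\frac{[(\alpha+1)n]_q}{n}z^n\Phi_4(z)$, $\;[h^i_{-n},\Phi_4(z)]=-\delta_{i2}q^{-(1+\frac12k)n}\frac{[(\alpha+1)n]_q}{n}z^{-n}\Phi_4(z)$;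 2. $[\Phi^*_1(z),X^{+,i}(w)]=0$, $\;q^{h^i_0}\Phi^*_1(z)q^{-h^i_0}=q^{\alpha\delta_{i2}}\Phi^*_1(z)$, $[h^i_n,\Phi^*_1(z)]=\delta_{i2}q^{\frac32kn}\frac{[\alpha n]_q}{n}z^n\Phi^*_1(z)$, $\;[h^i_{-n},\Phi^*_1(z)]=\delta_{i2}q^{-\frac12kn}\frac{[\alpha n]_q}{n}z^{-n}\Phi^*_1(z)$; 3. $[\Psi_1(z),X^{-,i}(w)]=0$, $\;q^{h^i_0}\Psi_1(z)q^{-h^i_0}=q^{-\alpha\delta_{i2}}\Psi_1(z)$, $[h^i_n,\Psi_1(z)]=-\delta_{i2}q^{\frac12kn}\frac{[\alpha n]_q}{n}z^n\Psi_1(z)$, $\;[h^i_{-n},\Psi_1(z)]=-\delta_{i2}q^{-\frac32kn}\frac{[\alpha n]_q}{n}z^{-n}\Psi_1(z)$; 4. $[\Psi^*_4(z),X^{-,i}(w)]=0$, $\;q^{h^i_0}\Psi^*_4(z)q^{-h^i_0}=q^{(\alpha+1)\delta_{i2}}\Psi^*_4(z)$, $[h^i_n,\Psi^*_4(z)]=\delta_{i2}q^{(\frac12k-1)n}\frac{[(\alpha+1)n]_q}{n}z^n\Psi^*_4(z)$,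 $\;[h^i_{-n},\Psi^*_4(z)]=\delta_{i2}q^{(-\frac32k+1)n}\frac{[(\alpha+1)n]_q}{n}z^{-n}\Psi^*_4(z)$. -/

import Mathlib

open scoped TensorProduct

noncomputable section

namespace QAffSl21

/-! ### Numbers -/

/-- `q^x`, where `q = exp ℏ`. -/
def qpow (ℏ x : ℂ) : ℂ := Complex.exp (ℏ * x)

/-- The `q`-number `[x]_q = (q^x - q^{-x}) / (q - q^{-1})`. -/
def qnum (ℏ x : ℂ) : ℂ := (qpow ℏ x - qpow ℏ (-x)) / (qpow ℏ 1 - qpow ℏ (-1))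

/-! ### The algebra in Drinfeld generators -/

/-- The two nodes `1`, `2` of the finite Dynkin diagram of `sl(2|1)`. -/
inductive Node
  | one
  | two
  deriving DecidableEq

/-- The symmetric Cartan matrix of `sl(2|1)`. -/
def cartan : Node → Node → ℤ
  | .one, .one => 2
  | .one, .two => -1
  | .two, .one => -1
  | .two, .two => 0

/-- The sign `(-1)^{[X^{±,i}] [X^{±,j}]}`: only the generators `X^{±,2}` are odd. -/
def swapSign : Node → Node → ℂ
  | .two, .two => -1
  | _, _ => 1

/-- The Kronecker symbol `δ_{i2}`. -/
def deltaTwo : Node → ℂ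
  | .one => 0
  | .two => 1

/-- The Drinfeld generators; a sign is an element of `ℤˣ = {1, -1}`. -/
inductive Gen
  /-- `X^{±,i}_m` -/
  | X (ε : ℤˣ) (i : Node) (m : ℤ)
  /-- `h^i_n`, `n ≠ 0` -/
  | h (i : Node) (n : ℤ) (hn : n ≠ 0)
  /-- `q^{± h^i_0}` -/
  | K (ε : ℤˣ) (i : Node)
  /-- `q^{± c/2}` -/
  | G (ε : ℤˣ)
  /-- the derivation `d` -/
  | D

/-- The parity of a Drinfeld generator. -/
def Gen.odd : Gen → Bool
  | .X _ .two _ => true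
  | _ => false

/-- The free algebra on the Drinfeld generators. -/
abbrev Free : Type := FreeAlgebra ℂ Gen

namespace Free

def X (ε : ℤˣ) (i : Node) (m : ℤ) : Free := FreeAlgebra.ι ℂ (.X ε i m)

/-- `h^i_n` for `n ≠ 0`; the value at `n = 0` is a placeholder. -/
def h (i : Node) (n : ℤ) : Free := if hn : n ≠ 0 then FreeAlgebra.ι ℂ (.h i n hn) else 0

def K (ε : ℤˣ) (i : Node) : Free := FreeAlgebra.ι ℂ (.K ε i)

def G (ε : ℤˣ) : Free := FreeAlgebra.ι ℂ (.G ε)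

def D : Free := FreeAlgebra.ι ℂ .D

/-- `q^{l c/2}` for an integer `l`. -/
def Gpow (l : ℤ) : Free := G 1 ^ l.toNat * G (-1) ^ (-l).toNat

/-- The exponent `± (q - q^{-1}) ∑_{n > 0} h^i_{± n} x^n`, a power series in `x = z^{∓ 1}`. -/
def psiExponent (ℏ : ℂ) (ε : ℤˣ) (i : Node) : PowerSeries Free :=
  PowerSeries.mk fun n =>
    (((ε : ℤ) : ℂ) * (qpow ℏ 1 - qpow ℏ (-1))) • h i ((ε : ℤ) * (n : ℤ))

/-- The coefficient of `x^n` in the exponential of a power series `A` without constant term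
(the powers `A^j` with `j > n` do not contribute to it). -/
def expCoeff (A : PowerSeries Free) (n : ℕ) : Free :=
  ∑ j ∈ Finset.range (n + 1), ((Nat.factorial j : ℂ)⁻¹) • PowerSeries.coeff n (A ^ j)

/-- `ψ^{±,i}_n`, given by
`∑_n ψ^{±,i}_n z^{-n} = q^{± h^i_0} exp (± (q - q^{-1}) ∑_{n > 0} h^i_{± n} z^{∓ n})`. -/
def psi (ℏ : ℂ) (ε : ℤˣ) (i : Node) (n : ℤ) : Free :=
  if 0 ≤ (ε : ℤ) * n then K ε i * expCoeff (psiExponent ℏ ε i) ((ε : ℤ) * n).toNat else 0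

end Free

/-- `x y - ξ y x`. -/
def qcomm {A : Type*} [Ring A] [Algebra ℂ A] (ξ : ℂ) (x y : A) : A := x * y - ξ • (y * x)

open Free in
/-- The defining relations between the Drinfeld generators. -/
inductive Rel (ℏ : ℂ) : Free → Free → Prop
  | G_inv (ε : ℤˣ) : Rel ℏ (G ε * G (-ε)) 1
  | G_central (ε : ℤˣ) (g : Gen) :
      Rel ℏ (G ε * FreeAlgebra.ι ℂ g) (FreeAlgebra.ι ℂ g * G ε)
  | K_inv (ε : ℤˣ) (i : Node) : Rel ℏ (K ε i * K (-ε) i) 1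
  | K_K (ε ε' : ℤˣ) (i j : Node) : Rel ℏ (K ε i * K ε' j) (K ε' j * K ε i)
  | K_h (ε : ℤˣ) (i j : Node) (m : ℤ) (hm : m ≠ 0) : Rel ℏ (K ε i * h j m) (h j m * K ε i)
  | D_K (ε : ℤˣ) (i : Node) : Rel ℏ (D * K ε i) (K ε i * D)
  | D_h (i : Node) (m : ℤ) (hm : m ≠ 0) : Rel ℏ (D * h i m - h i m * D) ((m : ℂ) • h i m)
  | D_X (ε : ℤˣ) (i : Node) (m : ℤ) : Rel ℏ (D * X ε i m - X ε i m * D) ((m : ℂ) • X ε i m)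
  | h_h (i j : Node) (m n : ℤ) (hm : m ≠ 0) (hn : n ≠ 0) :
      Rel ℏ (h i m * h j n - h j n * h i m)
        (if m + n = 0 then
          (qnum ℏ ((cartan i j * m : ℤ) : ℂ) / (m : ℂ) / (qpow ℏ 1 - qpow ℏ (-1))) •
            (Gpow (2 * m) - Gpow (-(2 * m)))
        else 0)
  | K_X (ε : ℤˣ) (i j : Node) (m : ℤ) :
      Rel ℏ (K 1 i * X ε j m * K (-1) i) (qpow ℏ (((ε : ℤ) * cartan i j : ℤ) : ℂ) • X ε j m)
  | h_X (ε : ℤˣ) (i j : Node) (m n : ℤ) (hm : m ≠ 0) :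
      Rel ℏ (h i m * X ε j n - X ε j n * h i m)
        ((((ε : ℤ) : ℂ) * (qnum ℏ ((cartan i j * m : ℤ) : ℂ) / (m : ℂ))) •
          (Gpow (-((ε : ℤ) * |m|)) * X ε j (n + m)))
  | X_X (i j : Node) (m n : ℤ) :
      Rel ℏ (qcomm (swapSign i j) (X 1 i m) (X (-1) j n))
        (if i = j then
          (qpow ℏ 1 - qpow ℏ (-1))⁻¹ •
            (Gpow (m - n) * psi ℏ 1 j (m + n) - Gpow (-(m - n)) * psi ℏ (-1) j (m + n))
        else 0)
  | odd_sq (ε : ℤˣ) (m n : ℤ) : Rel ℏ (X ε .two m * X ε .two n + X ε .two n * X ε .two m) 0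
  | quad (ε : ℤˣ) (i j : Node) (hij : cartan i j ≠ 0) (m n : ℤ) :
      Rel ℏ
        (qcomm (qpow ℏ (((ε : ℤ) * cartan i j : ℤ) : ℂ)) (X ε i (m + 1)) (X ε j n) +
          qcomm (qpow ℏ (((ε : ℤ) * cartan i j : ℤ) : ℂ)) (X ε j (n + 1)) (X ε i m)) 0
  | serre (ε : ℤˣ) (n₁ n₂ m : ℤ) :
      Rel ℏ
        (qcomm (qpow ℏ 1) (X ε .one n₁) (qcomm (qpow ℏ (-1)) (X ε .one n₂) (X ε .two m)) +
          qcomm (qpow ℏ 1) (X ε .one n₂) (qcomm (qpow ℏ (-1)) (X ε .one n₁) (X ε .two m))) 0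

/-- The quantum affine superalgebra `U_q[sl(2|1)^]`, `q = exp ℏ`. -/
abbrev Uq (ℏ : ℂ) : Type := RingQuot (Rel ℏ)

/-- The generators of `U_q[sl(2|1)^]`. -/
def gen (ℏ : ℂ) (g : Gen) : Uq ℏ := RingQuot.mkAlgHom ℂ (Rel ℏ) (FreeAlgebra.ι ℂ g)

/-! ### Chevalley generators and the coproduct -/

/-- Names of the Chevalley generators `e_i`, `f_i`, `q^{± h_i}`, `i = 0, 1, 2`. -/
inductive Chev
  | e (i : Fin 3)
  | f (i : Fin 3)
  | k (ε : ℤˣ) (i : Fin 3)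

/-- The Chevalley generators as elements of `U_q[sl(2|1)^]`. -/
def chev (ℏ : ℂ) : Chev → Uq ℏ
  | .e 0 => -(qcomm (qpow ℏ (-1)) (gen ℏ (.X (-1) .two 0)) (gen ℏ (.X (-1) .one 1)) *
      gen ℏ (.K (-1) .one) * gen ℏ (.K (-1) .two))
  | .e 1 => gen ℏ (.X 1 .one 0)
  | .e 2 => gen ℏ (.X 1 .two 0)
  | .f 0 => gen ℏ (.K 1 .one) * gen ℏ (.K 1 .two) *
      qcomm (qpow ℏ 1) (gen ℏ (.X 1 .one (-1))) (gen ℏ (.X 1 .two 0))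
  | .f 1 => gen ℏ (.X (-1) .one 0)
  | .f 2 => gen ℏ (.X (-1) .two 0)
  | .k ε 0 => gen ℏ (.G ε) ^ 2 * gen ℏ (.K (-ε) .one) * gen ℏ (.K (-ε) .two)
  | .k ε 1 => gen ℏ (.K ε .one)
  | .k ε 2 => gen ℏ (.K ε .two)

/-- The parity (`0` or `1`) of the Chevalley generators; `none` stands for the unit. -/
def par : Option Chev → ℕ
  | some (.e 0) => 1
  | some (.e 2) => 1
  | some (.f 0) => 1
  | some (.f 2) => 1
  | _ => 0

/-- The coproduct of the Chevalley generators, `(a, b)` standing for `a ⊗ b` and `none` for `1`: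
`Δ(e_i) = e_i ⊗ 1 + q^{h_i} ⊗ e_i`, `Δ(f_i) = f_i ⊗ q^{-h_i} + 1 ⊗ f_i`,
`Δ(q^{h_i}) = q^{h_i} ⊗ q^{h_i}`. -/
def coproduct : Chev → List (Option Chev × Option Chev)
  | .e i => [(some (.e i), none), (some (.k 1 i), some (.e i))]
  | .f i => [(some (.f i), some (.k (-1) i)), (none, some (.f i))]
  | .k ε i => [(some (.k ε i), some (.k ε i))]

/-! ### Modules of level `k` -/

/-- A `ℤ/2`-graded `U_q[sl(2|1)^]`-module structure of level `k` on the space `M`.  The grading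
is given by the parity operator `P`, equal to `1` on even and to `-1` on odd vectors. -/
structure LevelModule (ℏ k : ℂ) (M : Type*) [AddCommGroup M] [Module ℂ M] where
  /-- the action -/
  act : Uq ℏ →ₐ[ℂ] Module.End ℂ M
  /-- the parity operator -/
  P : Module.End ℂ M
  P_mul_P : P * P = 1
  even_comm : ∀ g : Gen, g.odd = false → P * act (gen ℏ g) = act (gen ℏ g) * P
  odd_anticomm : ∀ g : Gen, g.odd = true → P * act (gen ℏ g) = -(act (gen ℏ g) * P)
  /-- the central element `c` acts as `k` -/
  level : ∀ ε : ℤˣ, act (gen ℏ (.G ε)) = qpow ℏ (((ε : ℤ) : ℂ) * k / 2) • 1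

/-- The action of a Chevalley generator, or of `1`. -/
def LevelModule.chevAct {ℏ k : ℂ} {M : Type*} [AddCommGroup M] [Module ℂ M]
    (L : LevelModule ℏ k M) : Option Chev → Module.End ℂ M
  | some x => L.act (chev ℏ x)
  | none => 1

/-! ### The evaluation modules

The space of both modules is `ℂ⁴`; the basis vectors `v_1, …, v_4` have the indices `0, …, 3`.
With the spectral parameter `z` included, a Chevalley generator `x` acts as
`z^(zdeg x) • π x`, where `π x` is a constant matrix. -/

/-- The underlying space of the evaluation modules. -/
abbrev V4 : Type := Fin 4 → ℂ

/-- The power of `z` in the action of a Chevalley generator (or of `1`). -/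
def zdeg : Option Chev → ℤ
  | some (.e 0) => 1
  | some (.f 0) => -1
  | _ => 0

/-- The parity operator of `V_α`: `v_1, v_4` are even and `v_2, v_3` are odd. -/
def parV : Matrix (Fin 4) (Fin 4) ℂ := Matrix.diagonal ![1, -1, -1, 1]

/-- The matrices of the Chevalley generators on `V_{α,z}` without the powers of `z`; `s` and `t`
are the chosen square roots of `[α]_q` and `[α+1]_q`. -/
def evalRep (ℏ α s t : ℂ) : Option Chev → Matrix (Fin 4) (Fin 4) ℂ
  | none => 1
  | some (.e 0) =>
      !![0, 0, 0, 0;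
         0, 0, 0, 0;
         s, 0, 0, 0;
         0, -t, 0, 0]
  | some (.e 1) =>
      !![0, 0, 0, 0;
         0, 0, 1, 0;
         0, 0, 0, 0;
         0, 0, 0, 0]
  | some (.e 2) =>
      !![0, s, 0, 0;
         0, 0, 0, 0;
         0, 0, 0, t;
         0, 0, 0, 0]
  | some (.f 0) =>
      !![0, 0, -s, 0;
         0, 0, 0, t;
         0, 0, 0, 0;
         0, 0, 0, 0]
  | some (.f 1) =>
      !![0, 0, 0, 0;
         0, 0, 0, 0;
         0, 1, 0, 0;
         0, 0, 0, 0]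
  | some (.f 2) =>
      !![0, 0, 0, 0;
         s, 0, 0, 0;
         0, 0, 0, 0;
         0, 0, t, 0]
  | some (.k ε 0) => Matrix.diagonal fun r =>
      qpow ℏ (((ε : ℤ) : ℂ) * ![-α, -(α + 1), -α, -(α + 1)] r)
  | some (.k ε 1) => Matrix.diagonal fun r => qpow ℏ (((ε : ℤ) : ℂ) * ![0, 1, -1, 0] r)
  | some (.k ε 2) => Matrix.diagonal fun r =>
      qpow ℏ (((ε : ℤ) : ℂ) * ![α, α, α + 1, α + 1] r)

/-- The matrices of the Chevalley generators on the dual module `V^{*S}_{α,z}` (the supertransposes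
of the matrices of the antipodes), without the powers of `z`, in the basis `v*_1, …, v*_4`. -/
def evalRepDual (ℏ α s t : ℂ) : Option Chev → Matrix (Fin 4) (Fin 4) ℂ
  | none => 1
  | some (.e 0) =>
      !![0, 0, -(qpow ℏ α * s), 0;
         0, 0, 0, -(qpow ℏ (α + 1) * t);
         0, 0, 0, 0;
         0, 0, 0, 0]
  | some (.e 1) =>
      !![0, 0, 0, 0;
         0, 0, 0, 0;
         0, -qpow ℏ (-1), 0, 0;
         0, 0, 0, 0]
  | some (.e 2) =>
      !![0, 0, 0, 0;
         qpow ℏ (-α) * s, 0, 0, 0;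
         0, 0, 0, 0;
         0, 0, -(qpow ℏ (-α - 1) * t), 0]
  | some (.f 0) =>
      !![0, 0, 0, 0;
         0, 0, 0, 0;
         -(qpow ℏ (-α) * s), 0, 0, 0;
         0, -(qpow ℏ (-α - 1) * t), 0, 0]
  | some (.f 1) =>
      !![0, 0, 0, 0;
         0, 0, -qpow ℏ 1, 0;
         0, 0, 0, 0;
         0, 0, 0, 0]
  | some (.f 2) =>
      !![0, -(qpow ℏ α * s), 0, 0;
         0, 0, 0, 0;
         0, 0, 0, qpow ℏ (α + 1) * t;
         0, 0, 0, 0]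
  | some (.k ε 0) => Matrix.diagonal fun r =>
      qpow ℏ (((ε : ℤ) : ℂ) * ![α, α + 1, α, α + 1] r)
  | some (.k ε 1) => Matrix.diagonal fun r => qpow ℏ (((ε : ℤ) : ℂ) * ![0, -1, 1, 0] r)
  | some (.k ε 2) => Matrix.diagonal fun r =>
      qpow ℏ (((ε : ℤ) : ℂ) * ![-α, -α, -(α + 1), -(α + 1)] r)

/-! ### Vertex operators

A vertex operator is a formal series `Θ(z) = ∑_n Θ_n z^n`.  The operators `a`, `b` act on
tensor products by the sign rule `(a ⊗ b)(u ⊗ v) = (-1)^{[b][u]} a u ⊗ b v`. -/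

section

variable {ℏ k : ℂ} {M N : Type*} [AddCommGroup M] [Module ℂ M] [AddCommGroup N] [Module ℂ N]

/-- `Φ(z) : M → N ⊗ V_z` is an even intertwiner (type I), `V_z` being the evaluation module given
by the matrices `π`. -/
structure IsTypeI (L : LevelModule ℏ k M) (R : LevelModule ℏ k N)
    (π : Option Chev → Matrix (Fin 4) (Fin 4) ℂ) (Φ : ℤ → M →ₗ[ℂ] N ⊗[ℂ] V4) : Prop where
  even : ∀ n, Φ n ∘ₗ L.P = TensorProduct.map R.P (Matrix.toLin' parV) ∘ₗ Φ n
  intertwines : ∀ (x : Chev) (n : ℤ), Φ n ∘ₗ L.act (chev ℏ x) =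
    ((coproduct x).map fun ab =>
      TensorProduct.map (R.chevAct ab.1 * R.P ^ par ab.2) (Matrix.toLin' (π ab.2)) ∘ₗ
        Φ (n - zdeg ab.2)).sum

/-- `Ψ(z) : M → V_z ⊗ N` is an even intertwiner (type II), `V_z` being the evaluation module given
by the matrices `π`. -/
structure IsTypeII (L : LevelModule ℏ k M) (R : LevelModule ℏ k N)
    (π : Option Chev → Matrix (Fin 4) (Fin 4) ℂ) (Ψ : ℤ → M →ₗ[ℂ] V4 ⊗[ℂ] N) : Prop where
  even : ∀ n, Ψ n ∘ₗ L.P = TensorProduct.map (Matrix.toLin' parV) R.P ∘ₗ Ψ n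
  intertwines : ∀ (x : Chev) (n : ℤ), Ψ n ∘ₗ L.act (chev ℏ x) =
    ((coproduct x).map fun ab =>
      TensorProduct.map (Matrix.toLin' (π ab.1 * parV ^ par ab.2)) (R.chevAct ab.2) ∘ₗ
        Ψ (n - zdeg ab.1)).sum

/-- The component `Φ_r(z)` of `Φ(z) = ∑_r Φ_r(z) ⊗ v_r` (`r = 0, …, 3`), as the family of the
coefficients of `z^n`. -/
def compI (Φ : ℤ → M →ₗ[ℂ] N ⊗[ℂ] V4) (r : Fin 4) (n : ℤ) : M →ₗ[ℂ] N :=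
  (TensorProduct.rid ℂ N).toLinearMap ∘ₗ
    TensorProduct.map LinearMap.id (LinearMap.proj r) ∘ₗ Φ n

/-- The component `Ψ_r(z)` of `Ψ(z) = ∑_r v_r ⊗ Ψ_r(z)` (`r = 0, …, 3`), as the family of the
coefficients of `z^n`. -/
def compII (Ψ : ℤ → M →ₗ[ℂ] V4 ⊗[ℂ] N) (r : Fin 4) (n : ℤ) : M →ₗ[ℂ] N :=
  (TensorProduct.lid ℂ N).toLinearMap ∘ₗ
    TensorProduct.map (LinearMap.proj r) LinearMap.id ∘ₗ Ψ n

/-- `[F(z), X^{±,i}(w)] = 0` for an even operator `F(z) = ∑_n F_n z^n`, where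
`X^{±,i}(w) = ∑_m X^{±,i}_m w^{-m-1}`. -/
def CommutesWithX (L : LevelModule ℏ k M) (R : LevelModule ℏ k N) (F : ℤ → M →ₗ[ℂ] N)
    (ε : ℤˣ) (i : Node) : Prop :=
  ∀ m n : ℤ, F n ∘ₗ L.act (gen ℏ (.X ε i m)) = R.act (gen ℏ (.X ε i m)) ∘ₗ F n

/-- `q^{h^i_0} F(z) q^{-h^i_0} = q^x F(z)`. -/
def HasWeight (L : LevelModule ℏ k M) (R : LevelModule ℏ k N) (F : ℤ → M →ₗ[ℂ] N)
    (i : Node) (x : ℂ) : Prop :=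
  ∀ n : ℤ, R.act (gen ℏ (.K 1 i)) ∘ₗ F n ∘ₗ L.act (gen ℏ (.K (-1) i)) = qpow ℏ x • F n

/-- `[h^i_l, F(z)] = a z^l F(z)`. -/
def HCommutator (L : LevelModule ℏ k M) (R : LevelModule ℏ k N) (F : ℤ → M →ₗ[ℂ] N)
    (i : Node) (l : ℤ) (hl : l ≠ 0) (a : ℂ) : Prop :=
  ∀ n : ℤ, R.act (gen ℏ (.h i l hl)) ∘ₗ F n - F n ∘ₗ L.act (gen ℏ (.h i l hl)) =
    a • F (n - l)

end

end QAffSl21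

end

/-!
Let `F(z)` be one of the four components in question, say `Φ_4(z)`. The intertwining relations with
the Chevalley generators say that `F(z)` commutes with `X^{+,1}_0`, `X^{+,2}_0`,
`X^{-,1}_0` and `q^{h^1_0}`, that it commutes up to a factor `λ = q^a` with `q^{h^2_0}` and with
`f_0`, and that the failure of `F(z)` to commute with `X^{-,2}_0` and with `e_0` is governed by two
further components. Everything else follows from the Drinfeld relations.

* Commuting `f_0` with `X^{-,1}_0` gives `X^{+,2}_{-1}`, so `F` commutes with it
  (`IsExtremal.commute_X_two_neg_one`). Commuting `e_0` with `X^{+,1}_0` gives `X^{-,2}_1`, and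
  eliminating the further components leaves the exchange relation
  `F X^{-,2}_{m+1} - λ X^{-,2}_{m+1} F = λ q^{k+b} z (F X^{-,2}_m - λ⁻¹ X^{-,2}_m F)` for `m = 0`
  (`IsExtremal.exchange_zero`).
* Its anticommutators with `X^{+,2}_0` and `X^{+,2}_{-1}` show that `[h^2_{±1}, F]` is a multiple of
  `z^{±1} F`. Since `h^2_{±1}` shifts the modes of `X^{±,1}`, the component `F` commutes with all
  `X^{±,1}_m`, hence with all `h^1_n`; as `h^1_{±1}` shifts the modes of `X^{±,2}`, it commutes with
  all `X^{+,2}_m`, and the exchange relation holds for all `m`. Only the modes `h^i_{±1}` are used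
  for shifting: their structure constants are `±1` up to powers of `q`, while those of `h^i_n` may
  vanish at roots of unity.
* The anticommutator of the exchange relation with `X^{+,2}_0` is a relation
  `(1 - A z x) F p(x) = (1 - B z x) p(x) F` for `p(x) = exp (± (q - q⁻¹) ∑ h^2_{±n} x^n)`, whose
  logarithm (`commutator_log_of_exchange`) is the formula for `[h^2_{±n}, F]`.

Components of the operators of type II are treated by the same argument after applying the
involution `X^{±,i}_m ↦ X^{∓,i}_{-m}`, `c ↦ -c` of the Drinfeld relations (`Currents.flip`). To
compute in a single algebra, `U_q[sl(2|1)^]`, the variable `z` and the components are made to act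
on `M ⊕ N[[z, z⁻¹]]`.
-/

noncomputable section

namespace QAffSl21

/-! ### Exponentials and logarithms of power series over a noncommutative algebra -/

/-- A power series with constant coefficient `1` can be cancelled on the left. -/
theorem eq_zero_of_mul_eq_zero_of_constantCoeff {A : Type*} [Ring A] (f g : PowerSeries A)
    (hf : PowerSeries.coeff 0 f = 1) (hfg : f * g = 0) : g = 0 := by
  ext n
  induction n using Nat.strong_induction_on with
  | _ n ih =>
    have h := congrArg (PowerSeries.coeff n) hfg
    rw [PowerSeries.coeff_mul, Finset.sum_eq_single (0, n)] at h
    · simpa [hf] using h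
    · intro ab hab hne
      have hab := Finset.HasAntidiagonal.mem_antidiagonal.mp hab
      have : ab.2 < n := by
        rcases Nat.eq_zero_or_pos ab.1 with h1 | h1
        · exact absurd (Prod.ext h1 (by simp; omega)) hne
        · omega
      rw [ih _ this, map_zero, mul_zero]
    · simp

theorem coeff_pow_eq_zero {A : Type*} [Ring A] (H : PowerSeries A)
    (h0 : PowerSeries.coeff 0 H = 0) :
    ∀ {j n : ℕ}, n < j → PowerSeries.coeff n (H ^ j) = 0 := by
  intro j
  induction j with
  | zero => intro n hn; omega
  | succ j ih =>
    intro n hn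
    rw [pow_succ, PowerSeries.coeff_mul]
    refine Finset.sum_eq_zero fun ab hab => ?_
    have hab := Finset.HasAntidiagonal.mem_antidiagonal.mp hab
    rcases Nat.eq_zero_or_pos ab.2 with hb | hb
    · rw [hb, h0, mul_zero]
    · rw [ih (by omega), zero_mul]

section PowerSeries

variable {A : Type*} [Ring A] [Algebra ℂ A]

/-- The Euler operator `x d/dx` on power series over a possibly noncommutative ring. -/
def euler (f : PowerSeries A) : PowerSeries A :=
  PowerSeries.mk fun n => (n : ℂ) • PowerSeries.coeff n f

theorem coeff_smul_complex (c : ℂ) (f : PowerSeries A) (n : ℕ) :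
    PowerSeries.coeff n (c • f) = c • PowerSeries.coeff n f := rfl

theorem coeff_euler (f : PowerSeries A) (n : ℕ) :
    PowerSeries.coeff n (euler f) = (n : ℂ) • PowerSeries.coeff n f := by
  simp [euler]

theorem euler_mul (f g : PowerSeries A) : euler (f * g) = euler f * g + f * euler g := by
  ext n
  simp only [map_add, coeff_euler, PowerSeries.coeff_mul, Finset.smul_sum,
    ← Finset.sum_add_distrib]
  refine Finset.sum_congr rfl fun ij hij => ?_
  rw [← Finset.HasAntidiagonal.mem_antidiagonal.mp hij, smul_mul_assoc, mul_smul_comm,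
    ← add_smul, Nat.cast_add]

/-- `x d/dx H^{j+1} = (j+1) H^j · x dH/dx`, if `H` commutes with `x dH/dx`. -/
theorem euler_pow_succ (H : PowerSeries A) (hH : Commute H (euler H)) (j : ℕ) :
    euler (H ^ (j + 1)) = ((j + 1 : ℕ) : ℂ) • (H ^ j * euler H) := by
  induction j with
  | zero => simp
  | succ j ih =>
    rw [pow_succ, euler_mul, ih, smul_mul_assoc, mul_assoc, ← hH.eq, ← mul_assoc, ← pow_succ]
    push_cast
    module

/-- The coefficient of `x^n` in `exp H`, for a power series `H` without constant term. -/
def expTerm (H : PowerSeries A) (n : ℕ) : A :=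
  ∑ j ∈ Finset.range (n + 1), ((Nat.factorial j : ℂ)⁻¹) • PowerSeries.coeff n (H ^ j)

theorem expTerm_eq_sum (H : PowerSeries A) (h0 : PowerSeries.coeff 0 H = 0) {n N : ℕ}
    (hN : n < N) :
    expTerm H n =
      ∑ j ∈ Finset.range N, ((Nat.factorial j : ℂ)⁻¹) • PowerSeries.coeff n (H ^ j) := by
  refine Finset.sum_subset (Finset.range_mono hN) fun j _ hj => ?_
  rw [coeff_pow_eq_zero H h0 (by simpa [Nat.lt_succ_iff] using hj), smul_zero]

/-- `x d/dx exp H = exp H · x dH/dx`, if the coefficients of `H` commute. -/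
theorem euler_expTerm (H : PowerSeries A) (h0 : PowerSeries.coeff 0 H = 0)
    (hH : Commute H (euler H)) :
    euler (PowerSeries.mk (expTerm H)) = PowerSeries.mk (expTerm H) * euler H := by
  ext n
  rw [coeff_euler, PowerSeries.coeff_mk, PowerSeries.coeff_mul]
  have key : ∀ j, (n : ℂ) • (((Nat.factorial (j + 1) : ℂ)⁻¹) • PowerSeries.coeff n (H ^ (j + 1))) =
      ((Nat.factorial j : ℂ)⁻¹) • PowerSeries.coeff n (H ^ j * euler H) := by
    intro j
    have h1 := congrArg (PowerSeries.coeff n) (euler_pow_succ H hH j)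
    rw [coeff_euler, coeff_smul_complex] at h1
    rw [smul_comm, h1, smul_smul, Nat.factorial_succ]
    congr 1
    have : ((j + 1 : ℕ) : ℂ) ≠ 0 := Nat.cast_ne_zero.mpr (Nat.succ_ne_zero j)
    push_cast at this ⊢
    field_simp
  have hz : (n : ℂ) • (((Nat.factorial 0 : ℂ)⁻¹) • PowerSeries.coeff n (H ^ 0)) = 0 := by
    rcases n with _ | n
    · simp
    · simp [PowerSeries.coeff_one]
  rw [expTerm_eq_sum H h0 (Nat.lt_succ_of_lt (Nat.lt_succ_self n)), Finset.smul_sum,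
    Finset.sum_range_succ', hz, add_zero, Finset.sum_congr rfl fun j _ => key j]
  simp only [PowerSeries.coeff_mul, Finset.smul_sum]
  rw [Finset.sum_comm]
  refine Finset.sum_congr rfl fun ab hab => ?_
  have hab := Finset.HasAntidiagonal.mem_antidiagonal.mp hab
  rw [PowerSeries.coeff_mk, expTerm_eq_sum H h0 (show ab.1 < n + 1 by omega), Finset.sum_mul]
  simp only [smul_mul_assoc]

/-- Taking logarithms: if `(1 - a z x) F p(x) = (1 - b z x) p(x) F`, where `p` has the logarithm `H`,
then `F H = H F + log ((1 - b z x) / (1 - a z x)) F`. The proof compares logarithmic derivatives;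
`z` need not commute with `F`. -/
theorem commutator_log_of_exchange (p H : PowerSeries A) (hp0 : PowerSeries.coeff 0 p = 1)
    (hp : euler p = p * euler H) (F z : A) (a b : ℂ)
    (hzp : ∀ n, Commute z (PowerSeries.coeff n p))
    (hF : ∀ n, F * PowerSeries.coeff (n + 1) p - a • (z * F * PowerSeries.coeff n p) =
      PowerSeries.coeff (n + 1) p * F - b • (z * PowerSeries.coeff n p * F)) (n : ℕ) :
    (n : ℂ) • (F * PowerSeries.coeff n H - PowerSeries.coeff n H * F) =
      (a ^ n - b ^ n) • (z ^ n * F) := by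
  set f : PowerSeries A := PowerSeries.C F with hf
  set w : PowerSeries A := PowerSeries.C z * PowerSeries.X with hw
  have cw0 : ∀ g : PowerSeries A, PowerSeries.coeff 0 (w * g) = 0 := fun g => by
    rw [hw, mul_assoc, PowerSeries.coeff_C_mul, PowerSeries.coeff_zero_X_mul, mul_zero]
  have cw : ∀ (g : PowerSeries A) (n : ℕ),
      PowerSeries.coeff (n + 1) (w * g) = z * PowerSeries.coeff n g := fun g n => by
    rw [hw, mul_assoc, PowerSeries.coeff_C_mul, PowerSeries.coeff_succ_X_mul]
  have hwp : w * p = p * w := by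
    rw [hw, mul_assoc, PowerSeries.X_mul, ← mul_assoc, ← mul_assoc]
    congr 1
    ext n
    rw [PowerSeries.coeff_C_mul, PowerSeries.coeff_mul_C, (hzp n).eq]
  have ex : f * p - a • (w * (f * p)) = p * f - b • (w * (p * f)) := by
    ext n
    rcases n with _ | n
    · simp only [map_sub, coeff_smul_complex, cw0, hf, PowerSeries.coeff_C_mul,
        PowerSeries.coeff_mul_C]
      simp [hp0]
    · simp only [map_sub, coeff_smul_complex, cw, hf, PowerSeries.coeff_C_mul,
        PowerSeries.coeff_mul_C]
      simpa only [mul_assoc] using hF n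
  have ew : euler w = w := by
    ext n
    rw [coeff_euler, hw, PowerSeries.coeff_C_mul, PowerSeries.coeff_X]
    split_ifs with h
    · simp [h]
    · simp
  have ef : euler f = 0 := by
    ext n
    rw [coeff_euler, hf, PowerSeries.coeff_C]
    split_ifs with h
    · simp [h]
    · simp
  have esub : ∀ g g' : PowerSeries A, euler (g - g') = euler g - euler g' := fun g g' => by
    ext n; simp [coeff_euler, smul_sub]
  have esmul : ∀ (c : ℂ) (g : PowerSeries A), euler (c • g) = c • euler g := fun c g => by
    ext n; simp only [coeff_euler, coeff_smul_complex, smul_comm c]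
  have dex := congrArg euler ex
  simp only [esub, esmul, euler_mul, ew, ef, hp, zero_mul, zero_add, mul_zero, add_zero] at dex
  -- subtracting the exchange relation times `x dH/dx` removes the derivative of `p`
  have ex' := congrArg (· * euler H) ex
  simp only [sub_mul, smul_mul_assoc, mul_assoc] at ex' dex
  have hη := coeff_euler H
  generalize euler H = η at *
  obtain ⟨c, hc⟩ : ∃ c, c = f * η - η * f := ⟨_, rfl⟩
  have h1 : p * c - b • (w * (p * c)) = a • (w * (f * p)) - b • (w * (p * f)) := by
    simp only [hc, mul_sub, smul_sub, smul_add] at dex ⊢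
    linear_combination (norm := module) dex - ex'
  -- after multiplication by `1 - a z x` the series `p` can be cancelled on the left
  have hpw : ∀ g : PowerSeries A, w * (p * g) = p * (w * g) := fun g => by
    rw [← mul_assoc, hwp, mul_assoc]
  have h2 : c - (a + b) • (w * c) + (a * b) • (w * (w * c)) = (a - b) • (w * f) := by
    refine sub_eq_zero.mp (eq_zero_of_mul_eq_zero_of_constantCoeff p _ hp0 ?_)
    have h1w := congrArg (w * ·) h1
    have exw := congrArg (w * ·) ex
    simp only [mul_sub, mul_add, mul_smul_comm, hpw] at h1 h1w ex exw ⊢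
    linear_combination (norm := module) h1 - a • h1w + a • exw
  -- `∑ aⁿ zⁿ F xⁿ` is the expansion of `(1 - a z x)⁻¹ F`
  have hG : ∀ a : ℂ, ∃ G : PowerSeries A, (∀ n, PowerSeries.coeff n G = a ^ n • (z ^ n * F)) ∧
      G - a • (w * G) = f := by
    intro a
    refine ⟨PowerSeries.mk fun n => a ^ n • (z ^ n * F), fun n => PowerSeries.coeff_mk _ _, ?_⟩
    ext n
    rw [map_sub, coeff_smul_complex]
    rcases n with _ | n
    · rw [cw0, hf, PowerSeries.coeff_mk, PowerSeries.coeff_C]; simp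
    · rw [cw, hf, PowerSeries.coeff_mk, PowerSeries.coeff_mk, PowerSeries.coeff_C]
      simp only [mul_smul_comm, smul_smul, pow_succ', mul_assoc, sub_self]
      simp
  obtain ⟨Ga, hGa, hGa'⟩ := hG a
  obtain ⟨Gb, hGb, hGb'⟩ := hG b
  have h3 : c = Ga - Gb := by
    have hu : (1 - (a + b) • w + (a * b) • (w * w)) * (c - (Ga - Gb)) = 0 := by
      have hGaw := congrArg (w * ·) hGa'
      have hGbw := congrArg (w * ·) hGb'
      simp only [mul_sub, sub_mul, add_mul, mul_smul_comm, smul_mul_assoc, one_mul, mul_assoc]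
        at hGaw hGbw ⊢
      linear_combination (norm := module) h2 - hGa' + b • hGaw + hGb' - a • hGbw
    refine sub_eq_zero.mp (eq_zero_of_mul_eq_zero_of_constantCoeff _ _ ?_ hu)
    have := cw0 1
    rw [mul_one] at this
    rw [map_add, map_sub, coeff_smul_complex, coeff_smul_complex, this, cw0]
    simp
  have h4 := congrArg (PowerSeries.coeff n) h3
  rw [hc, map_sub, map_sub, hGa, hGb, hf, PowerSeries.coeff_C_mul, PowerSeries.coeff_mul_C, hη n,
    mul_smul_comm, smul_mul_assoc] at h4
  rw [smul_sub, h4, sub_smul]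

end PowerSeries

/-! ### Currents and extremal components -/

section Scalars

theorem qpow_add (ℏ x y : ℂ) : qpow ℏ (x + y) = qpow ℏ x * qpow ℏ y := by
  rw [qpow, mul_add, Complex.exp_add, qpow, qpow]

theorem qpow_zero (ℏ : ℂ) : qpow ℏ 0 = 1 := by simp [qpow]

theorem qpow_mul_qpow_neg (ℏ x : ℂ) : qpow ℏ x * qpow ℏ (-x) = 1 := by
  rw [← qpow_add, add_neg_cancel, qpow_zero]

theorem qpow_ne_zero (ℏ x : ℂ) : qpow ℏ x ≠ 0 := Complex.exp_ne_zero _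

theorem qpow_pow (ℏ x : ℂ) (n : ℕ) : qpow ℏ x ^ n = qpow ℏ (x * n) := by
  rw [qpow, qpow, ← Complex.exp_nat_mul]; ring_nf

end Scalars

/-- Elements of an algebra satisfying those Drinfeld relations of `U_q[sl(2|1)^]` at level `k` which
determine the commutation of a vertex operator with the currents. The relation between `h^i_m` and
`X^{±,j}_n` is included only for `m = ±1` and `i ≠ j`, and the exponential generating functions `p`
are characterized by their logarithmic derivatives. -/
structure Currents (ℏ k : ℂ) (A : Type*) [Ring A] [Algebra ℂ A] where
  /-- `X^{±,i}_m` -/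
  X : ℤˣ → Node → ℤ → A
  /-- `h^i_m`; the element `h^i_0` is irrelevant -/
  h : Node → ℤ → A
  /-- `q^{± h^i_0}` -/
  K : ℤˣ → Node → A
  /-- `exp (± (q - q^{-1}) ∑_{n > 0} h^i_{± n} x^n)` -/
  p : ℤˣ → Node → PowerSeries A
  K_mul_K : ∀ ε i, K ε i * K (-ε) i = 1
  K_X : ∀ ε' ε i j m, K ε' i * X ε j m =
    qpow ℏ (((ε' : ℤ) * ((ε : ℤ) * cartan i j) : ℤ) : ℂ) • (X ε j m * K ε' i)
  h_X : ∀ ε (σ : ℤˣ) i j m, i ≠ j → h i σ * X ε j m - X ε j m * h i σ =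
    (-((ε : ℤ) : ℂ) * qpow ℏ (-((ε : ℤ) : ℂ) * k / 2)) • X ε j (m + σ)
  p_zero : ∀ ε i, PowerSeries.coeff 0 (p ε i) = 1
  euler_p : ∀ ε i, euler (p ε i) = p ε i * euler (PowerSeries.mk fun n =>
    (((ε : ℤ) : ℂ) * (qpow ℏ 1 - qpow ℏ (-1))) • h i ((ε : ℤ) * (n : ℤ)))
  X_X : ∀ i m n, X 1 i m * X (-1) i n - swapSign i i • (X (-1) i n * X 1 i m) =
    (qpow ℏ 1 - qpow ℏ (-1))⁻¹ •
      (qpow ℏ (((m - n : ℤ) : ℂ) * k / 2) •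
          (if 0 ≤ m + n then K 1 i * PowerSeries.coeff (m + n).toNat (p 1 i) else 0) -
        qpow ℏ (-((m - n : ℤ) : ℂ) * k / 2) •
          (if m + n ≤ 0 then K (-1) i * PowerSeries.coeff (-(m + n)).toNat (p (-1) i) else 0))
  X_X_ne : ∀ i j m n, i ≠ j → X 1 i m * X (-1) j n = X (-1) j n * X 1 i m

/-- The coefficients of `p = exp H` are polynomials in those of `H`. -/
theorem commute_of_euler {A : Type*} [Ring A] [Algebra ℂ A] {p H : PowerSeries A}
    (hp0 : PowerSeries.coeff 0 p = 1) (hp : euler p = p * euler H) {z : A}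
    (hz : ∀ n, 0 < n → Commute z (PowerSeries.coeff n H)) (n : ℕ) :
    Commute z (PowerSeries.coeff n p) := by
  induction n using Nat.strong_induction_on with
  | _ n ih =>
    rcases Nat.eq_zero_or_pos n with rfl | hn
    · rw [hp0]; exact Commute.one_right z
    · have h := congrArg (PowerSeries.coeff n) hp
      rw [coeff_euler, PowerSeries.coeff_mul] at h
      have hn' : (n : ℂ) ≠ 0 := Nat.cast_ne_zero.mpr hn.ne'
      rw [← inv_smul_smul₀ hn' (PowerSeries.coeff n p), h]
      refine Commute.smul_right (Commute.sum_right _ _ _ fun ab hab => ?_) _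
      have hab := Finset.HasAntidiagonal.mem_antidiagonal.mp hab
      rw [coeff_euler]
      rcases Nat.eq_zero_or_pos ab.2 with h2 | h2
      · simp [h2]
      · exact (ih _ (by omega)).mul_right ((hz _ h2).smul_right _)

theorem coeff_one_of_euler {A : Type*} [Ring A] [Algebra ℂ A] {p H : PowerSeries A}
    (hp0 : PowerSeries.coeff 0 p = 1) (hp : euler p = p * euler H) :
    PowerSeries.coeff 1 p = PowerSeries.coeff 1 H := by
  have h := congrArg (PowerSeries.coeff 1) hp
  rw [coeff_euler, PowerSeries.coeff_mul, Finset.Nat.antidiagonal_succ] at h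
  simpa [coeff_euler, hp0] using h

/-- The relations satisfied by an extremal component `F(z)` of a vertex operator (such as `Φ_4(z)`
for type I); `F₁(z)` and `F₂(z)` are multiples of the components to which `X^{-,2}_0` and the
affine Chevalley generator connect it. Multiplication by the formal variable is an element `z`. In
`F_lower` and `F_raise` the affine generators appear without their Cartan factors; `q^a` is the
weight of `F`, and `b` records the ratio of the two couplings to `F₁`. -/
structure IsExtremal {ℏ k : ℂ} {A : Type*} [Ring A] [Algebra ℂ A] (C : Currents ℏ k A)
    (z : Aˣ) (a b : ℂ) (F F₁ F₂ : A) : Prop where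
  z_X : ∀ ε i m, Commute (z : A) (C.X ε i m)
  z_h : ∀ i m, m ≠ 0 → Commute (z : A) (C.h i m)
  z_K : ∀ ε i, Commute (z : A) (C.K ε i)
  F_X : ∀ i, Commute F (C.X 1 i 0)
  F_Y : Commute F (C.X (-1) .one 0)
  F_K_one : Commute F (C.K 1 .one)
  F_K_two : F * C.K 1 .two = qpow ℏ a • (C.K 1 .two * F)
  F_lower : Commute F (C.X 1 .one (-1) * C.X 1 .two 0 -
    qpow ℏ 1 • (C.X 1 .two 0 * C.X 1 .one (-1)))
  F_Y_two : F * C.X (-1) .two 0 - qpow ℏ (-a) • (C.X (-1) .two 0 * F) = F₁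
  F_raise : F * (C.X (-1) .two 0 * C.X (-1) .one 1 -
      qpow ℏ (-1) • (C.X (-1) .one 1 * C.X (-1) .two 0)) -
    qpow ℏ a • ((C.X (-1) .two 0 * C.X (-1) .one 1 -
      qpow ℏ (-1) • (C.X (-1) .one 1 * C.X (-1) .two 0)) * F) = z * F₂
  F₂_X : F₂ * C.X 1 .one 0 - C.X 1 .one 0 * F₂ = qpow ℏ (a + k + b - 1) • (C.K 1 .one * F₁)

/-- If `w` commutes with `F`, and `[u, F] = g F` where `g` commutes with `w`, then `[u, w]` commutes
with `F`. -/
theorem commute_commutator {A : Type*} [Ring A] {F w g u : A} (hw : Commute F w)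
    (hu : u * F - F * u = g * F)
    (hg : Commute g w) : Commute F (u * w - w * u) := by
  have h1 := congrArg (· * w) hu
  have h2 := congrArg (w * ·) hu
  have h3 := congrArg (u * ·) hw.eq
  have h4 := congrArg (· * u) hw.eq
  have h5 := congrArg (g * ·) hw.eq
  have h6 := congrArg (· * F) hg.eq
  rw [commute_iff_eq]
  simp only [mul_sub, sub_mul, mul_assoc] at h1 h2 h3 h4 h5 h6 ⊢
  linear_combination (norm := abel) h2 - h1 + h3 - h4 - h5 - h6

section Extremal

variable {ℏ k : ℂ} {A : Type*} [Ring A] [Algebra ℂ A] (C : Currents ℏ k A)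

namespace Currents

theorem coeff_one_p (ε : ℤˣ) (i : Node) : PowerSeries.coeff 1 (C.p ε i) =
    (((ε : ℤ) : ℂ) * (qpow ℏ 1 - qpow ℏ (-1))) • C.h i ε := by
  rw [coeff_one_of_euler (C.p_zero ε i) (C.euler_p ε i), PowerSeries.coeff_mk]
  simp

theorem isUnit_K (ε : ℤˣ) (i : Node) : IsUnit (C.K ε i) :=
  ⟨⟨C.K ε i, C.K (-ε) i, C.K_mul_K ε i, by simpa using C.K_mul_K (-ε) i⟩, rfl⟩

theorem mul_K_inv {F : A} {ε : ℤˣ} {i : Node} {x : ℂ}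
    (h : F * C.K ε i = qpow ℏ x • (C.K ε i * F)) :
    F * C.K (-ε) i = qpow ℏ (-x) • (C.K (-ε) i * F) := by
  have h1 := congrArg (fun u => C.K (-ε) i * u * C.K (-ε) i) h
  have h2 : C.K (-ε) i * C.K ε i = 1 := by simpa using C.K_mul_K (-ε) i
  have h3 : C.K ε i * C.K (-ε) i = 1 := C.K_mul_K ε i
  simp only [mul_smul_comm, smul_mul_assoc] at h1
  rw [mul_assoc, mul_assoc, h3, mul_one, ← mul_assoc, h2, one_mul] at h1
  rw [h1, smul_smul, mul_comm, qpow_mul_qpow_neg, one_smul]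

theorem commute_K_inv {F : A} {ε : ℤˣ} {i : Node} (h : Commute F (C.K ε i)) :
    Commute F (C.K (-ε) i) := by
  have := C.mul_K_inv (F := F) (ε := ε) (i := i) (x := 0)
    (by rw [qpow_zero, one_smul]; exact h.eq)
  rwa [neg_zero, qpow_zero, one_smul] at this

theorem X_one_neg_one_commutator (hq : qpow ℏ 1 ≠ qpow ℏ (-1)) :
    C.X 1 .one (-1) * C.X (-1) .one 0 - C.X (-1) .one 0 * C.X 1 .one (-1) =
      qpow ℏ (k / 2) • (C.K (-1) .one * C.h .one (-1)) := by
  have h := C.X_X .one (-1) 0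
  have hq' := sub_ne_zero.mpr hq
  have hp := C.coeff_one_p (-1) .one
  simp only [swapSign, one_smul, add_zero, Int.reduceNeg, Int.reduceLE, if_false, if_true,
    neg_neg, Int.toNat_one, Units.val_neg, Units.val_one, Int.reduceToNat] at h hp
  rw [h, hp]
  simp only [mul_smul_comm, smul_smul, smul_zero, zero_sub, ← neg_smul]
  congr 1
  simp only [sub_zero, Int.cast_neg, Int.cast_one, Int.reduceNeg]
  rw [show - -1 * k / 2 = k / 2 by ring]
  field_simp

theorem X_neg_one_one_commutator (hq : qpow ℏ 1 ≠ qpow ℏ (-1)) :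
    C.X 1 .one 0 * C.X (-1) .one 1 - C.X (-1) .one 1 * C.X 1 .one 0 =
      qpow ℏ (-k / 2) • (C.K 1 .one * C.h .one 1) := by
  have h := C.X_X .one 0 1
  have hq' := sub_ne_zero.mpr hq
  have hp := C.coeff_one_p 1 .one
  simp only [swapSign, one_smul, zero_add, Int.reduceLE, if_false, if_true,
    Int.toNat_one, Units.val_one, Int.reduceToNat] at h hp
  rw [h, hp]
  simp only [mul_smul_comm, smul_smul, smul_zero, sub_zero]
  congr 1
  simp only [zero_sub, Int.cast_neg, Int.cast_one, Int.reduceNeg]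
  rw [show -1 * k / 2 = -k / 2 by ring]
  field_simp

end Currents

namespace IsExtremal

variable {C : Currents ℏ k A} {z : Aˣ} {a b : ℂ} {F F₁ F₂ : A}

/-- `X^{+,2}_{-1}` is, up to an invertible factor, the commutator of
`[X^{+,1}_{-1}, X^{+,2}_0]_q` and `X^{-,1}_0`. -/
theorem commute_X_two_neg_one (hE : IsExtremal C z a b F F₁ F₂) (hq : qpow ℏ 1 ≠ qpow ℏ (-1)) :
    Commute F (C.X 1 .two (-1)) := by
  have hT := C.X_one_neg_one_commutator hq
  have hy := C.X_X_ne .two .one 0 0 (by decide)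
  have hK := C.K_X (-1) 1 .one .two 0
  have hh := C.h_X 1 (-1) .one .two 0 (by decide)
  have key : C.X 1 .two (-1) = -(C.K 1 .one *
      ((C.X 1 .one (-1) * C.X 1 .two 0 - qpow ℏ 1 • (C.X 1 .two 0 * C.X 1 .one (-1))) *
        C.X (-1) .one 0 - C.X (-1) .one 0 * (C.X 1 .one (-1) * C.X 1 .two 0 -
          qpow ℏ 1 • (C.X 1 .two 0 * C.X 1 .one (-1))))) := by
    norm_num [cartan] at hK hh
    have hr : qpow ℏ (k / 2) * qpow ℏ (-k / 2) = 1 := by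
      rw [neg_div, qpow_mul_qpow_neg]
    generalize qpow ℏ (k / 2) = r at *
    generalize qpow ℏ (-k / 2) = s at *
    generalize qpow ℏ 1 = q at *
    have e1 := congrArg (· * C.X 1 .two 0) hT
    have e2 := congrArg (C.X 1 .two 0 * ·) hT
    have e3 := congrArg (C.X 1 .one (-1) * ·) hy
    have e4 := congrArg (· * C.X 1 .one (-1)) hy
    have e5 := congrArg (· * C.h .one (-1)) hK
    have e6 := congrArg (C.K (-1) .one * ·) hh
    have e7 : (C.X 1 .one (-1) * C.X 1 .two 0 - q • (C.X 1 .two 0 * C.X 1 .one (-1))) *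
        C.X (-1) .one 0 - C.X (-1) .one 0 * (C.X 1 .one (-1) * C.X 1 .two 0 -
          q • (C.X 1 .two 0 * C.X 1 .one (-1))) = -(C.K (-1) .one * C.X 1 .two (-1)) := by
      have : -(C.K (-1) .one * C.X 1 .two (-1)) =
          (r * s) • -(C.K (-1) .one * C.X 1 .two (-1)) := by rw [hr, one_smul]
      rw [this]
      simp only [mul_sub, sub_mul, mul_assoc, mul_smul_comm, smul_mul_assoc, mul_neg]
        at e1 e2 e3 e4 e5 e6 ⊢
      linear_combination (norm := module) e1 - q • e2 + e3 - q • e4 + r • e5 + r • e6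
    rw [e7, mul_neg, neg_neg, ← mul_assoc, C.K_mul_K, one_mul]
  rw [key]
  exact (hE.F_K_one.mul_right ((hE.F_lower.mul_right hE.F_Y).sub_right
    (hE.F_Y.mul_right hE.F_lower))).neg_right

/-- The exchange relation between `F(z)` and `X^{-,2}(w)`, in modes: `X^{-,2}_0` and `X^{-,2}_1`
both connect `F` to `F₁`, the first one directly, the second one through the affine Chevalley
generator. -/
theorem exchange_zero (hE : IsExtremal C z a b F F₁ F₂) (hq : qpow ℏ 1 ≠ qpow ℏ (-1)) :
    F * C.X (-1) .two 1 - qpow ℏ a • (C.X (-1) .two 1 * F) = qpow ℏ (a + k + b) •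
      ((z : A) * (F * C.X (-1) .two 0 - qpow ℏ (-a) • (C.X (-1) .two 0 * F))) := by
  rw [hE.F_Y_two]
  have hT := C.X_neg_one_one_commutator hq
  have hx := C.X_X_ne .one .two 0 0 (by decide)
  have hK := C.K_X 1 (-1) .one .two 0
  have hh := C.h_X (-1) 1 .one .two 0 (by decide)
  have hF := hE.F_raise
  have hF₂ := hE.F₂_X
  have hFx := (hE.F_X .one).eq
  have hzx := (hE.z_X 1 .one 0).eq
  have hzK := (hE.z_K 1 .one).eq
  have hFK := hE.F_K_one.eq
  have hq1 := qpow_mul_qpow_neg ℏ 1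
  have hr : qpow ℏ (-k / 2) * qpow ℏ (k / 2) = 1 := by
    rw [neg_div, mul_comm, qpow_mul_qpow_neg]
  have hg : qpow ℏ (a + k + b) = qpow ℏ 1 * qpow ℏ (a + k + b - 1) := by
    rw [← qpow_add]; congr 1; ring
  rw [hg]
  norm_num [cartan] at hK hh
  generalize qpow ℏ (k / 2) = s at *
  generalize qpow ℏ (-k / 2) = r at *
  generalize qpow ℏ 1 = q at *
  generalize qpow ℏ (-1) = q' at *
  generalize qpow ℏ (a + k + b - 1) = g at *
  generalize qpow ℏ a = l at *
  obtain ⟨W, hW⟩ : ∃ W, W = C.X (-1) .two 0 * C.X (-1) .one 1 -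
      q' • (C.X (-1) .one 1 * C.X (-1) .two 0) := ⟨_, rfl⟩
  rw [← hW] at hF
  have hWx : W * C.X 1 .one 0 - C.X 1 .one 0 * W = q' • (C.K 1 .one * C.X (-1) .two 1) := by
    have e1 := congrArg (· * C.X (-1) .two 0) hT
    have e2 := congrArg (C.X (-1) .two 0 * ·) hT
    have e3 := congrArg (C.X (-1) .one 1 * ·) hx
    have e4 := congrArg (· * C.X (-1) .one 1) hx
    have e5 := congrArg (fun u => q' • (u * C.h .one 1)) hK
    have e6 := congrArg (C.K 1 .one * ·) hh
    have e5' : q' • (C.K 1 .one * C.X (-1) .two 0 * C.h .one 1) =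
        C.X (-1) .two 0 * C.K 1 .one * C.h .one 1 := by
      refine e5.trans ?_
      rw [smul_mul_assoc, smul_smul, mul_comm q' q, hq1, one_smul]
    have : q' • (C.K 1 .one * C.X (-1) .two 1) =
        (r * s) • (q' • (C.K 1 .one * C.X (-1) .two 1)) := by rw [hr, one_smul]
    rw [this, hW]
    simp only [mul_sub, sub_mul, mul_assoc, mul_smul_comm, smul_mul_assoc] at e1 e2 e3 e4 e5' e6 ⊢
    linear_combination (norm := module) q' • e1 - e2 + q' • e3 - e4 + r • e5' + (r * q') • e6
  -- commute both sides of the relation for the affine generator with `X^{+,1}_0`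
  have key : q' • (C.K 1 .one * (F * C.X (-1) .two 1 - l • (C.X (-1) .two 1 * F))) =
      g • (C.K 1 .one * (z * F₁)) := by
    have e1 := congrArg (· * C.X 1 .one 0) hF
    have e2 := congrArg (C.X 1 .one 0 * ·) hF
    have e3 := congrArg (W * ·) hFx
    have e4 := congrArg (· * W) hFx
    have e5 := congrArg (· * F₂) hzx
    have e6 := congrArg ((z : A) * ·) hF₂
    have e7 := congrArg (· * F₁) hzK
    have e8 := congrArg (F * ·) hWx
    have e9 := congrArg (· * F) hWx
    have e10 := congrArg (· * C.X (-1) .two 1) hFK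
    simp only [mul_sub, sub_mul, mul_assoc, mul_smul_comm, smul_mul_assoc]
      at e1 e2 e3 e4 e5 e6 e7 e8 e9 e10 ⊢
    linear_combination (norm := module) e1 - e2 + l • e3 - e4 + e5 + e6 + g • e7 - e8
      + l • e9 - q' • e10
  have hK' : C.K (-1) .one * C.K 1 .one = 1 := by simpa using C.K_mul_K (-1) .one
  have h2 := congrArg (fun u => q • (C.K (-1) .one * u)) key
  simp only [mul_smul_comm, ← mul_assoc, hK', one_mul, smul_smul, hq1, one_smul] at h2
  simpa only [mul_assoc] using h2

end IsExtremal
end Extremal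

/-! ### The exchange relation between `F(z)` and `exp (± (q - q⁻¹) ∑ h^2_{±n} x^n)` -/

/-- An exchange relation between `F` and `y`, `y'` persists for the anticommutators of `y`, `y'`
with an element `x` which commutes with `F`. -/
theorem exchange_anticommutator {A : Type*} [Ring A] [Algebra ℂ A] {F z x y y' : A} {l l' g : ℂ}
    (hF : Commute F x) (hz : Commute z x)
    (h : F * y' - l • (y' * F) = g • (z * (F * y - l' • (y * F)))) :
    F * (x * y' + y' * x) - l • ((x * y' + y' * x) * F) =
      g • (z * (F * (x * y + y * x) - l' • ((x * y + y * x) * F))) := by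
  have e1 := congrArg (x * ·) h
  have e2 := congrArg (· * x) h
  have e3 := congrArg (· * y') hF.eq
  have e4 := congrArg (y' * ·) hF.eq
  have e5 := congrArg (fun u => z * (u * y)) hF.eq
  have e6 := congrArg (fun u => z * (y * u)) hF.eq
  have e7 := congrArg (· * (F * y)) hz.eq
  have e8 := congrArg (· * (y * F)) hz.eq
  simp only [mul_sub, sub_mul, mul_add, add_mul, mul_assoc, mul_smul_comm, smul_mul_assoc]
    at e1 e2 e3 e4 e5 e6 e7 e8 ⊢
  linear_combination (norm := module) e1 + e2 + e3 + l • e4 - g • e5 - (g * l') • e6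
    - g • e7 + (g * l') • e8

section Extremal

variable {ℏ k : ℂ} {A : Type*} [Ring A] [Algebra ℂ A]

namespace Currents

variable (C : Currents ℏ k A)

/-- The exchange relation between `F(z)` and `X^{-,2}(w)`, in modes. -/
def Exchange (z : A) (a b : ℂ) (F : A) (m : ℤ) : Prop :=
  F * C.X (-1) .two (m + 1) - qpow ℏ a • (C.X (-1) .two (m + 1) * F) = qpow ℏ (a + k + b) •
    (z * (F * C.X (-1) .two m - qpow ℏ (-a) • (C.X (-1) .two m * F)))

theorem anticommutator_pos (n m : ℤ) (r : ℕ) (hr : n + m = r) :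
    C.X 1 .two n * C.X (-1) .two m + C.X (-1) .two m * C.X 1 .two n =
      (qpow ℏ 1 - qpow ℏ (-1))⁻¹ • (qpow ℏ ((n - m) * k / 2) •
        (C.K 1 .two * PowerSeries.coeff r (C.p 1 .two)) -
        qpow ℏ (-(n - m) * k / 2) • (if r = 0 then C.K (-1) .two else 0)) := by
  have h := C.X_X .two n m
  simp only [swapSign, neg_smul, one_smul, sub_neg_eq_add] at h
  rw [h, hr, if_pos (Int.natCast_nonneg r), Int.toNat_natCast]
  push_cast
  rcases Nat.eq_zero_or_pos r with rfl | h0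
  · simp [C.p_zero]
  · rw [if_neg (by omega), if_neg (by omega)]

theorem anticommutator_neg (n m : ℤ) (r : ℕ) (hr : n + m = -r) :
    C.X 1 .two n * C.X (-1) .two m + C.X (-1) .two m * C.X 1 .two n =
      (qpow ℏ 1 - qpow ℏ (-1))⁻¹ • (qpow ℏ ((n - m) * k / 2) •
        (if r = 0 then C.K 1 .two else 0) - qpow ℏ (-(n - m) * k / 2) •
        (C.K (-1) .two * PowerSeries.coeff r (C.p (-1) .two))) := by
  have h := C.X_X .two n m
  simp only [swapSign, neg_smul, one_smul, sub_neg_eq_add] at h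
  rw [h, hr, if_pos (show (-(r : ℤ)) ≤ 0 by omega), neg_neg, Int.toNat_natCast]
  push_cast
  rcases Nat.eq_zero_or_pos r with rfl | h0
  · simp [C.p_zero]
  · rw [if_neg (by omega), if_neg (by omega)]

end Currents

namespace IsExtremal

variable {C : Currents ℏ k A} {z : Aˣ} {a b : ℂ} {F F₁ F₂ : A}

/-- The anticommutator of the exchange relation with `X^{+,2}_n` in nonnegative degree. In
degree `0` the anticommutator also contains `q^{-h^2_0}`, which drops out since
`F q^{-h^2_0} = q^{-a} q^{-h^2_0} F`. -/
theorem exchange_p_pos (hE : IsExtremal C z a b F F₁ F₂) (hq : qpow ℏ 1 ≠ qpow ℏ (-1))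
    {n m : ℤ} (hx : Commute F (C.X 1 .two n)) (hm : C.Exchange z a b F m) {r : ℕ}
    (hr : n + m = r) :
    F * PowerSeries.coeff (r + 1) (C.p 1 .two) -
        qpow ℏ (a + k + b + k / 2) • ((z : A) * F * PowerSeries.coeff r (C.p 1 .two)) =
      PowerSeries.coeff (r + 1) (C.p 1 .two) * F -
        qpow ℏ (-a + k + b + k / 2) • ((z : A) * PowerSeries.coeff r (C.p 1 .two) * F) := by
  have h := exchange_anticommutator hx (hE.z_X 1 .two n) hm
  rw [C.anticommutator_pos n m r hr, C.anticommutator_pos n (m + 1) (r + 1) (by omega)] at h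
  rw [if_neg (Nat.succ_ne_zero r), smul_zero, sub_zero] at h
  have hD : F * (if r = 0 then C.K (-1) .two else 0) =
      qpow ℏ (-a) • ((if r = 0 then C.K (-1) .two else 0) * F) := by
    split_ifs
    · exact C.mul_K_inv hE.F_K_two
    · simp
  generalize (if r = 0 then C.K (-1) .two else 0) = D at *
  have hs : qpow ℏ ((n - m) * k / 2) = qpow ℏ ((n - (m + 1 : ℤ)) * k / 2) * qpow ℏ (k / 2) := by
    rw [← qpow_add]; congr 1; push_cast; ring
  have hA : qpow ℏ (a + k + b + k / 2) = qpow ℏ (a + k + b) * qpow ℏ (k / 2) := qpow_add _ _ _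
  have hB : qpow ℏ (-a + k + b + k / 2) =
      qpow ℏ (a + k + b) * qpow ℏ (k / 2) * (qpow ℏ (-a) * qpow ℏ (-a)) := by
    simp only [← qpow_add]; congr 1; ring
  have hl := qpow_mul_qpow_neg ℏ a
  have hK := hE.F_K_two
  have hzK := (hE.z_K 1 .two).eq
  rw [hs] at h
  rw [hA, hB]
  have hs0 := qpow_ne_zero ℏ ((n - (m + 1 : ℤ)) * k / 2)
  have hl0 := qpow_ne_zero ℏ a
  have he0 := inv_ne_zero (sub_ne_zero.mpr hq)
  generalize qpow ℏ ((n - (m + 1 : ℤ)) * k / 2) = s at *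
  generalize qpow ℏ (-(n - m) * k / 2) = s' at *
  generalize qpow ℏ (k / 2) = t at *
  generalize qpow ℏ (a + k + b) = g at *
  generalize qpow ℏ (-a) = l' at *
  generalize qpow ℏ a = l at *
  generalize (qpow ℏ 1 - qpow ℏ (-1))⁻¹ = e at *
  generalize PowerSeries.coeff (r + 1) (C.p 1 .two) = p' at *
  generalize PowerSeries.coeff r (C.p 1 .two) = p at *
  refine (C.isUnit_K 1 .two).mul_left_cancel ?_
  have hc : e * s * l ≠ 0 := mul_ne_zero (mul_ne_zero he0 hs0) hl0
  refine smul_right_injective A hc ?_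
  have e1 := congrArg (· * p') hK
  have e2 := congrArg (fun u => (z : A) * (u * p)) hK
  have e3 := congrArg ((z : A) * ·) hD
  have e4 := congrArg (· * (F * p)) hzK
  have e5 := congrArg (· * (p * F)) hzK
  simp only [mul_sub, sub_mul, mul_assoc, mul_smul_comm, smul_mul_assoc,
    smul_sub, smul_smul] at h e1 e2 e3 e4 e5 ⊢
  linear_combination (norm := module) h - (e * s) • e1 + (g * e * s * t) • e2 - (g * e * s') • e3
    + (g * e * s * t * l) • e4 - (g * e * s * t * l') • e5
    + hl • ((g * e * s * t * l') • (C.K 1 .two * ((z : A) * (p * F))))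

/-- The anticommutator of the exchange relation with `X^{+,2}_n` in negative degree, where
the coefficients of `exp (-(q - q⁻¹) ∑ h^2_{-n} x^n)` and the variable `z⁻¹` appear. -/
theorem exchange_p_neg (hE : IsExtremal C z a b F F₁ F₂) (hq : qpow ℏ 1 ≠ qpow ℏ (-1))
    {n m : ℤ} (hx : Commute F (C.X 1 .two n)) (hm : C.Exchange z a b F m) {r : ℕ}
    (hr : n + m = -((r + 1 : ℕ) : ℤ)) :
    F * PowerSeries.coeff (r + 1) (C.p (-1) .two) - qpow ℏ (-(a + k + b) + k / 2) •
        ((↑z⁻¹ : A) * F * PowerSeries.coeff r (C.p (-1) .two)) =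
      PowerSeries.coeff (r + 1) (C.p (-1) .two) * F - qpow ℏ (a - k - b + k / 2) •
        ((↑z⁻¹ : A) * PowerSeries.coeff r (C.p (-1) .two) * F) := by
  have h := exchange_anticommutator hx (hE.z_X 1 .two n) hm
  rw [C.anticommutator_neg n m (r + 1) hr, C.anticommutator_neg n (m + 1) r (by omega)] at h
  rw [if_neg (Nat.succ_ne_zero r), smul_zero, zero_sub] at h
  have hD : F * (if r = 0 then C.K 1 .two else 0) =
      qpow ℏ a • ((if r = 0 then C.K 1 .two else 0) * F) := by
    split_ifs
    · exact hE.F_K_two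
    · simp
  generalize (if r = 0 then C.K 1 .two else 0) = D at *
  have hs : qpow ℏ (-(n - (m + 1 : ℤ)) * k / 2) = qpow ℏ (-(n - m) * k / 2) * qpow ℏ (k / 2) := by
    rw [← qpow_add]; congr 1; push_cast; ring
  have hA : qpow ℏ (-(a + k + b) + k / 2) = qpow ℏ (-(a + k + b)) * qpow ℏ (k / 2) := qpow_add _ _ _
  have hB : qpow ℏ (a - k - b + k / 2) =
      qpow ℏ (-(a + k + b)) * qpow ℏ (k / 2) * (qpow ℏ a * qpow ℏ a) := by
    simp only [← qpow_add]; congr 1; ring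
  have hl := qpow_mul_qpow_neg ℏ a
  have hg := qpow_mul_qpow_neg ℏ (a + k + b)
  have hK := C.mul_K_inv hE.F_K_two
  have hzK := (hE.z_K (-1) .two).eq
  have hz' : (z : A) * (↑z⁻¹ : A) = 1 := z.mul_inv
  rw [hs] at h
  rw [hA, hB]
  have hs0 := qpow_ne_zero ℏ (-(n - m) * k / 2)
  have hl0 := qpow_ne_zero ℏ (-a)
  have hg0 := qpow_ne_zero ℏ (a + k + b)
  have he0 := inv_ne_zero (sub_ne_zero.mpr hq)
  generalize qpow ℏ ((n - (m + 1 : ℤ)) * k / 2) = s' at *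
  generalize qpow ℏ (-(n - m) * k / 2) = s at *
  generalize qpow ℏ (k / 2) = t at *
  generalize qpow ℏ (-(a + k + b)) = g' at *
  generalize qpow ℏ (a + k + b) = g at *
  generalize qpow ℏ (-a) = l' at *
  generalize qpow ℏ a = l at *
  generalize (qpow ℏ 1 - qpow ℏ (-1))⁻¹ = e at *
  generalize PowerSeries.coeff (r + 1) (C.p (-1) .two) = p' at *
  generalize PowerSeries.coeff r (C.p (-1) .two) = p at *
  refine z.isUnit.mul_left_cancel ((C.isUnit_K (-1) .two).mul_left_cancel ?_)
  have hc : e * s * l' * g ≠ 0 := mul_ne_zero (mul_ne_zero (mul_ne_zero he0 hs0) hl0) hg0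
  refine smul_right_injective A hc ?_
  have hz1 : ∀ u : A, (z : A) * ((↑z⁻¹ : A) * u) = u := fun u => by rw [← mul_assoc, hz', one_mul]
  have e1 := congrArg (fun u => (z : A) * (u * p')) hK
  have e2 := congrArg (· * p) hK
  have e4 := congrArg (· * (F * p')) hzK
  have e5 := congrArg (· * (p' * F)) hzK
  simp only [mul_sub, sub_mul, mul_assoc, mul_smul_comm, smul_mul_assoc,
    smul_sub, smul_smul, mul_neg, neg_mul, smul_neg, hz1] at h hD e1 e2 e4 e5 ⊢
  linear_combination (norm := module) h - (e * s') • hD + (e * s * t) • e2 - (e * s * g) • e1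
    - (g * e * s * l') • e4 + (g * e * s * l') • e5
    - hg • ((e * s * l' * t) • (C.K (-1) .two * (F * p)))
    + hg • ((e * s * t * l * l * l') • (C.K (-1) .two * (p * F)))
    + hl • ((e * s * t * l) • (C.K (-1) .two * (p * F)))

end IsExtremal
end Extremal

/-! ### Commutation of extremal components with all currents -/

section Extremal

variable {ℏ k : ℂ} {A : Type*} [Ring A] [Algebra ℂ A]

namespace Currents

variable (C : Currents ℏ k A)

/-- The modes of `X^{±,j}` are shifted by `h^i_{±1}`, `i ≠ j`. -/
theorem commute_X_shift {F g : A} {ε σ : ℤˣ} {i j : Node} (hij : i ≠ j) {m : ℤ}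
    (hF : Commute F (C.X ε j m)) (hg : Commute g (C.X ε j m))
    (hh : C.h i σ * F - F * C.h i σ = g * F) : Commute F (C.X ε j (m + σ)) := by
  have h := commute_commutator hF hh hg
  rw [C.h_X ε σ i j m hij] at h
  refine (Commute.smul_right_iff₀ (mul_ne_zero ?_ (qpow_ne_zero _ _))).mp h
  exact neg_ne_zero.mpr (Int.cast_ne_zero.mpr ε.ne_zero)

theorem commute_X_all {F : A} {g : ℤˣ → A} {ε : ℤˣ} {i j : Node} (hij : i ≠ j)
    (hF : Commute F (C.X ε j 0)) (hg : ∀ σ m, Commute (g σ) (C.X ε j m))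
    (hh : ∀ σ : ℤˣ, C.h i σ * F - F * C.h i σ = g σ * F) (m : ℤ) : Commute F (C.X ε j m) := by
  induction m using Int.induction_on with
  | zero => exact hF
  | succ m ih => simpa using C.commute_X_shift hij ih (hg 1 _) (hh 1)
  | pred m ih => simpa [sub_eq_add_neg] using C.commute_X_shift hij ih (hg (-1) _) (hh (-1))

/-- The coefficients of `exp (± (q - q⁻¹) ∑ h^1_{±n} x^n)` are, up to invertible factors,
commutators of `X^{+,1}_{±n}` and `X^{-,1}_0`. -/
theorem commute_p_one {F : A} (hq : qpow ℏ 1 ≠ qpow ℏ (-1))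
    (hK : Commute F (C.K 1 .one)) (hX : ∀ ε m, Commute F (C.X ε .one m)) (ε : ℤˣ) (n : ℕ) :
    Commute F (PowerSeries.coeff n (C.p ε .one)) := by
  rcases Nat.eq_zero_or_pos n with rfl | hn
  · rw [C.p_zero]; exact Commute.one_right F
  have hK' : Commute F (C.K (-1) .one) := C.commute_K_inv hK
  have hc := inv_ne_zero (sub_ne_zero.mpr hq)
  have hK_all : ∀ ε, Commute F (C.K ε .one) := fun ε => by
    rcases Int.units_eq_one_or ε with rfl | rfl <;> assumption
  suffices h : Commute F (C.K ε .one * PowerSeries.coeff n (C.p ε .one)) by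
    have := (hK_all (-ε)).mul_right h
    rwa [← mul_assoc, show C.K (-ε) .one * C.K ε .one = 1 by simpa using C.K_mul_K (-ε) .one,
      one_mul] at this
  have comm : ∀ m, Commute F (C.X 1 .one m * C.X (-1) .one 0 -
      swapSign .one .one • (C.X (-1) .one 0 * C.X 1 .one m)) := fun m =>
    ((hX _ _).mul_right (hX _ _)).sub_right (((hX _ _).mul_right (hX _ _)).smul_right _)
  rcases Int.units_eq_one_or ε with rfl | rfl
  · have h := comm n
    rw [C.X_X, add_zero, if_pos (by omega), if_neg (by omega), smul_zero, sub_zero,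
      Commute.smul_right_iff₀ hc, Commute.smul_right_iff₀ (qpow_ne_zero _ _),
      Int.toNat_natCast] at h
    exact h
  · have h := comm (-n)
    rw [C.X_X, add_zero, if_neg (by omega), if_pos (by omega), smul_zero, zero_sub, neg_neg,
      Commute.smul_right_iff₀ hc, ← smul_neg, Commute.smul_right_iff₀ (qpow_ne_zero _ _),
      Int.toNat_natCast, Commute.neg_right_iff] at h
    exact h

/-- The commutators of `F` with `h^i_{±n}` from an exchange relation with
`exp (± (q - q⁻¹) ∑ h^i_{±n} x^n)`. -/
theorem commutator_h_of_exchange {F z : A} {a b : ℂ} (hq : qpow ℏ 1 ≠ qpow ℏ (-1)) (ε : ℤˣ)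
    (i : Node) (hz : ∀ m, m ≠ 0 → Commute z (C.h i m))
    (hF : ∀ n, F * PowerSeries.coeff (n + 1) (C.p ε i) -
        a • (z * F * PowerSeries.coeff n (C.p ε i)) =
      PowerSeries.coeff (n + 1) (C.p ε i) * F - b • (z * PowerSeries.coeff n (C.p ε i) * F))
    (n : ℕ) (hn : 0 < n) :
    C.h i ((ε : ℤ) * n) * F - F * C.h i ((ε : ℤ) * n) =
      (-((ε : ℤ) : ℂ) * ((a ^ n - b ^ n) / (qpow ℏ 1 - qpow ℏ (-1)) / n)) • (z ^ n * F) := by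
  have hc := sub_ne_zero.mpr hq
  have h := commutator_log_of_exchange (C.p ε i) _ (C.p_zero ε i) (C.euler_p ε i) F z a b
    (commute_of_euler (C.p_zero ε i) (C.euler_p ε i) fun m hm => by
      rw [PowerSeries.coeff_mk]
      exact (hz _ (mul_ne_zero ε.ne_zero (by omega))).smul_right _) hF n
  rw [PowerSeries.coeff_mk, mul_smul_comm, smul_mul_assoc, ← smul_sub, smul_smul] at h
  have hn' : (n : ℂ) ≠ 0 := Nat.cast_ne_zero.mpr hn.ne'
  have hε : ((ε : ℤ) : ℂ) * ((ε : ℤ) : ℂ) = 1 := by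
    rcases Int.units_eq_one_or ε with rfl | rfl <;> simp
  have hu : (n : ℂ) * (((ε : ℤ) : ℂ) * (qpow ℏ 1 - qpow ℏ (-1))) ≠ 0 :=
    mul_ne_zero hn' (mul_ne_zero (left_ne_zero_of_mul_eq_one hε) hc)
  refine smul_right_injective A hu ?_
  simp only
  rw [← neg_sub (F * _), smul_neg, h, smul_smul, ← neg_smul]
  congr 1
  field_simp
  linear_combination (a ^ n - b ^ n) * hε

/-- The modes of the exchange relation are shifted by `h^1_{±1}`, which commutes with `F`
and `z`. -/
theorem exchange_shift {z F : A} {a b : ℂ} {m : ℤ} (σ : ℤˣ) (hz : Commute z (C.h .one σ))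
    (hF : Commute F (C.h .one σ)) (h : C.Exchange z a b F m) : C.Exchange z a b F (m + σ) := by
  have key : ∀ (n : ℤ) (u : ℂ), C.h .one σ * (F * C.X (-1) .two n - u • (C.X (-1) .two n * F)) -
      (F * C.X (-1) .two n - u • (C.X (-1) .two n * F)) * C.h .one σ =
      qpow ℏ (k / 2) • (F * C.X (-1) .two (n + σ) - u • (C.X (-1) .two (n + σ) * F)) := by
    intro n u
    have h1 := C.h_X (-1) σ .one .two n (by decide)
    rw [show (-(((-1 : ℤˣ) : ℤ) : ℂ) * qpow ℏ (-(((-1 : ℤˣ) : ℤ) : ℂ) * k / 2)) = qpow ℏ (k / 2) by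
      simp] at h1
    have e1 := congrArg (F * ·) h1
    have e2 := congrArg (· * F) h1
    have e3 := congrArg (· * C.X (-1) .two n) hF.eq
    have e4 := congrArg (C.X (-1) .two n * ·) hF.eq
    simp only [mul_sub, sub_mul, mul_assoc, mul_smul_comm, smul_mul_assoc] at e1 e2 e3 e4 ⊢
    linear_combination (norm := module) e1 - u • e2 - e3 + u • e4
  unfold Exchange at h ⊢
  have k1 := key (m + 1) (qpow ℏ a)
  have k2 := congrArg (z * ·) (key m (qpow ℏ (-a)))
  have e0 := congrArg (C.h .one σ * ·) h
  have e1 := congrArg (· * C.h .one σ) h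
  have e2 := congrArg (· * (F * C.X (-1) .two m - qpow ℏ (-a) • (C.X (-1) .two m * F))) hz.eq
  rw [show m + 1 + (σ : ℤ) = m + σ + 1 by ring] at k1
  refine smul_right_injective A (qpow_ne_zero ℏ (k / 2)) ?_
  generalize F * C.X (-1) .two m - qpow ℏ (-a) • (C.X (-1) .two m * F) = U at *
  generalize F * C.X (-1) .two (m + 1) - qpow ℏ a • (C.X (-1) .two (m + 1) * F) = U' at *
  generalize F * C.X (-1) .two (m + σ) - qpow ℏ (-a) • (C.X (-1) .two (m + σ) * F) = V at *
  generalize F * C.X (-1) .two (m + σ + 1) - qpow ℏ a • (C.X (-1) .two (m + σ + 1) * F) = V' at *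
  simp only [mul_sub, mul_assoc, mul_smul_comm, smul_mul_assoc] at e0 e1 e2 k1 k2 ⊢
  linear_combination (norm := module) -k1 + e0 - e1 + qpow ℏ (a + k + b) • k2 -
    qpow ℏ (a + k + b) • e2

end Currents

namespace IsExtremal

variable {C : Currents ℏ k A} {z : Aˣ} {a b : ℂ} {F F₁ F₂ : A}

/-- The exchange relation with `X^{-,2}` yields `[h^2_{±1}, F] = c z^{±1} F`, and `h^2_{±1}`
shifts the modes of `X^{±,1}`. -/
theorem commute_X_one (hE : IsExtremal C z a b F F₁ F₂) (hq : qpow ℏ 1 ≠ qpow ℏ (-1))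
    (ε : ℤˣ) (m : ℤ) : Commute F (C.X ε .one m) := by
  have hc := sub_ne_zero.mpr hq
  have h0 : C.Exchange z a b F 0 := hE.exchange_zero hq
  have h1 : ∀ σ : ℤˣ, ∃ c : ℂ, ∃ w : Aˣ, (w = z ∨ w = z⁻¹) ∧
      C.h .two σ * F - F * C.h .two σ = (c • (w : A)) * F := by
    intro σ
    have hp := C.coeff_one_p σ .two
    -- the `x`-coefficient of the exchange relation for `exp (± (q - q⁻¹) ∑ h^2_{±n} x^n)`
    have step : ∀ (w : Aˣ) (u v : ℂ), (w = z ∨ w = z⁻¹) →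
        F * PowerSeries.coeff 1 (C.p σ .two) -
            u • ((w : A) * F * PowerSeries.coeff 0 (C.p σ .two)) =
          PowerSeries.coeff 1 (C.p σ .two) * F -
            v • ((w : A) * PowerSeries.coeff 0 (C.p σ .two) * F) →
        ∃ c : ℂ, ∃ w : Aˣ, (w = z ∨ w = z⁻¹) ∧
          C.h .two σ * F - F * C.h .two σ = (c • (w : A)) * F := by
      intro w u v hw h
      have hσ := mul_ne_zero (Int.cast_ne_zero (α := ℂ).mpr σ.ne_zero) hc
      refine ⟨(((σ : ℤ) : ℂ) * (qpow ℏ 1 - qpow ℏ (-1)))⁻¹ * (v - u), w, hw,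
        smul_right_injective A hσ ?_⟩
      simp only
      rw [smul_mul_assoc, smul_smul, mul_inv_cancel_left₀ hσ]
      rw [hp, C.p_zero, mul_one, mul_one, mul_smul_comm, smul_mul_assoc] at h
      linear_combination (norm := module) -h
    rcases Int.units_eq_one_or σ with rfl | rfl
    · exact step z _ _ (Or.inl rfl)
        (hE.exchange_p_pos hq (n := 0) (m := 0) (r := 0) (hE.F_X .two) h0 rfl)
    · exact step z⁻¹ _ _ (Or.inr rfl)
        (hE.exchange_p_neg hq (n := -1) (m := 0) (r := 0) (hE.commute_X_two_neg_one hq) h0 rfl)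
  choose c w hw hcw using h1
  refine C.commute_X_all (i := .two) (g := fun σ => c σ • (w σ : A)) (by decide) ?_ ?_ hcw m
  · rcases Int.units_eq_one_or ε with rfl | rfl
    exacts [hE.F_X .one, hE.F_Y]
  · intro σ m
    refine Commute.smul_left ?_ _
    rcases hw σ with h | h <;> rw [h]
    exacts [hE.z_X _ _ _, (hE.z_X _ _ _).units_inv_left]

theorem commute_h_one (hE : IsExtremal C z a b F F₁ F₂) (hq : qpow ℏ 1 ≠ qpow ℏ (-1))
    (ε : ℤˣ) (n : ℕ) (hn : 0 < n) : Commute F (C.h .one ((ε : ℤ) * n)) := by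
  have h := C.commutator_h_of_exchange (F := F) (z := 1) (a := 0) (b := 0) hq ε .one
    (fun _ _ => Commute.one_left _) (fun n => by
      simpa using (C.commute_p_one hq hE.F_K_one (hE.commute_X_one hq) ε (n + 1)).eq) n hn
  rw [sub_self, zero_div, zero_div, mul_zero, zero_smul, sub_eq_zero] at h
  exact h.symm

theorem commute_h_one_unit (hE : IsExtremal C z a b F F₁ F₂) (hq : qpow ℏ 1 ≠ qpow ℏ (-1))
    (σ : ℤˣ) : Commute F (C.h .one σ) := by
  simpa using hE.commute_h_one hq σ 1 one_pos

theorem commute_X (hE : IsExtremal C z a b F F₁ F₂) (hq : qpow ℏ 1 ≠ qpow ℏ (-1))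
    (i : Node) (m : ℤ) : Commute F (C.X 1 i m) := by
  cases i with
  | one => exact hE.commute_X_one hq 1 m
  | two =>
    refine C.commute_X_all (i := .one) (g := fun _ => 0) (by decide) (hE.F_X .two)
      (fun _ _ => Commute.zero_left _) (fun σ => ?_) m
    rw [zero_mul, sub_eq_zero]
    exact (hE.commute_h_one_unit hq σ).eq.symm

theorem exchange (hE : IsExtremal C z a b F F₁ F₂) (hq : qpow ℏ 1 ≠ qpow ℏ (-1)) (m : ℤ) :
    C.Exchange z a b F m := by
  have hs : ∀ (σ : ℤˣ) m, C.Exchange z a b F m → C.Exchange z a b F (m + σ) := fun σ m h =>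
    C.exchange_shift σ (hE.z_h _ _ σ.ne_zero) (hE.commute_h_one_unit hq σ) h
  induction m using Int.induction_on with
  | zero => exact hE.exchange_zero hq
  | succ m ih => exact hs 1 _ ih
  | pred m ih => exact hs (-1) _ ih

theorem commutator_h_two_pos (hE : IsExtremal C z a b F F₁ F₂) (hq : qpow ℏ 1 ≠ qpow ℏ (-1))
    (n : ℕ) (hn : 0 < n) :
    C.h .two n * F - F * C.h .two n =
      (-(qpow ℏ ((b + 3 / 2 * k) * n) * (qnum ℏ (a * n) / n))) • ((z : A) ^ n * F) := by
  have h := C.commutator_h_of_exchange hq 1 .two (hE.z_h .two) (fun r =>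
    hE.exchange_p_pos hq (hE.commute_X hq .two 0) (hE.exchange hq r) (zero_add _)) n hn
  rw [Units.val_one, one_mul] at h
  rw [h, qpow_pow, qpow_pow,
    show (a + k + b + k / 2) * (n : ℂ) = (b + 3 / 2 * k) * n + a * n by ring,
    show (-a + k + b + k / 2) * (n : ℂ) = (b + 3 / 2 * k) * n + -(a * n) by ring, qpow_add,
    qpow_add, qnum]
  congr 1
  push_cast
  ring

theorem commutator_h_two_neg (hE : IsExtremal C z a b F F₁ F₂) (hq : qpow ℏ 1 ≠ qpow ℏ (-1))
    (n : ℕ) (hn : 0 < n) :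
    C.h .two (-n) * F - F * C.h .two (-n) =
      (-(qpow ℏ (-(b + 1 / 2 * k) * n) * (qnum ℏ (a * n) / n))) • ((↑z⁻¹ : A) ^ n * F) := by
  have h := C.commutator_h_of_exchange hq (-1) .two
    (fun m hm => (hE.z_h .two m hm).units_inv_left) (fun r =>
    hE.exchange_p_neg hq (hE.commute_X hq .two 0) (hE.exchange hq (-((r + 1 : ℕ) : ℤ)))
      (zero_add _)) n hn
  rw [Units.val_neg, Units.val_one, neg_one_mul] at h
  rw [h, qpow_pow, qpow_pow,
    show (-(a + k + b) + k / 2) * (n : ℂ) = -(b + 1 / 2 * k) * n + -(a * n) by ring,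
    show (a - k - b + k / 2) * (n : ℂ) = -(b + 1 / 2 * k) * n + a * n by ring, qpow_add, qpow_add,
    qnum]
  congr 1
  push_cast
  ring

end IsExtremal
end Extremal

/-! ### Currents from representations of the quantum affine superalgebra -/

section OfRep

variable {ℏ k : ℂ} {A : Type*} [Ring A] [Algebra ℂ A]

/-- The action of the free algebra on the Drinfeld generators induced by an action of
`U_q[sl(2|1)^]`. -/
def freeAct (ρ : Uq ℏ →ₐ[ℂ] A) : Free →ₐ[ℂ] A := ρ.comp (RingQuot.mkAlgHom ℂ (Rel ℏ))

theorem freeAct_eq (ρ : Uq ℏ →ₐ[ℂ] A) {x y : Free} (h : Rel ℏ x y) :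
    freeAct ρ x = freeAct ρ y :=
  congrArg ρ (RingQuot.mkAlgHom_rel ℂ h)

theorem freeAct_Gpow (ρ : Uq ℏ →ₐ[ℂ] A)
    (hG : ∀ ε : ℤˣ, ρ (gen ℏ (.G ε)) = qpow ℏ (((ε : ℤ) : ℂ) * k / 2) • 1) (l : ℤ) :
    freeAct ρ (Free.Gpow l) = qpow ℏ ((l : ℂ) * k / 2) • 1 := by
  have h : ∀ ε : ℤˣ, freeAct ρ (Free.G ε) = qpow ℏ (((ε : ℤ) : ℂ) * k / 2) • 1 := hG
  rw [Free.Gpow, map_mul, map_pow, map_pow, h, h, smul_pow, smul_pow, one_pow, one_pow,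
    smul_mul_smul_comm, one_mul, qpow_pow, qpow_pow, ← qpow_add]
  congr 2
  rcases le_total 0 l with hl | hl
  · obtain ⟨n, rfl⟩ := Int.eq_ofNat_of_zero_le hl
    simp; ring
  · obtain ⟨n, hn⟩ := Int.eq_ofNat_of_zero_le (neg_nonneg.mpr hl)
    obtain rfl : l = -n := by omega
    simp; ring

theorem freeAct_expCoeff (ρ : Uq ℏ →ₐ[ℂ] A) (f : PowerSeries Free) (n : ℕ) :
    freeAct ρ (Free.expCoeff f n) = expTerm (PowerSeries.map (freeAct ρ).toRingHom f) n := by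
  rw [Free.expCoeff, map_sum, expTerm]
  refine Finset.sum_congr rfl fun j _ => ?_
  rw [map_smul, ← map_pow, PowerSeries.coeff_map]
  rfl

theorem commute_euler_of_coeff {H : PowerSeries A}
    (h : ∀ m n, Commute (PowerSeries.coeff m H) (PowerSeries.coeff n H)) :
    Commute H (euler H) := by
  rw [commute_iff_eq]
  ext n
  rw [PowerSeries.coeff_mul, PowerSeries.coeff_mul, ← Finset.Nat.sum_antidiagonal_swap]
  refine Finset.sum_congr rfl fun ij _ => ?_
  simp only [Prod.fst_swap, Prod.snd_swap, coeff_euler, mul_smul_comm, smul_mul_assoc]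
  rw [(h _ _).eq]

theorem freeAct_h_commute (ρ : Uq ℏ →ₐ[ℂ] A) (ε : ℤˣ) (i : Node) (m n : ℕ) :
    Commute (freeAct ρ (Free.h i ((ε : ℤ) * m))) (freeAct ρ (Free.h i ((ε : ℤ) * n))) := by
  rcases Nat.eq_zero_or_pos m with rfl | hm
  · simp [Free.h]
  rcases Nat.eq_zero_or_pos n with rfl | hn
  · simp [Free.h]
  have h := freeAct_eq ρ (Rel.h_h (ℏ := ℏ) i i ((ε : ℤ) * m) ((ε : ℤ) * n)
    (mul_ne_zero ε.ne_zero (by omega)) (mul_ne_zero ε.ne_zero (by omega)))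
  rw [if_neg, map_sub, map_mul, map_mul, map_zero, sub_eq_zero] at h
  · exact h
  · rw [← mul_add]
    exact mul_ne_zero ε.ne_zero (by omega)

theorem freeAct_psi (ρ : Uq ℏ →ₐ[ℂ] A) (ε : ℤˣ) (i : Node) (n : ℤ) :
    freeAct ρ (Free.psi ℏ ε i n) = if 0 ≤ (ε : ℤ) * n then ρ (gen ℏ (.K ε i)) *
      expTerm (PowerSeries.map (freeAct ρ).toRingHom (Free.psiExponent ℏ ε i))
        ((ε : ℤ) * n).toNat else 0 := by
  rw [Free.psi]
  split_ifs
  · rw [map_mul, freeAct_expCoeff]; rfl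
  · exact map_zero _

/-- The operators of a representation of `U_q[sl(2|1)^]` of level `k`. -/
def Currents.ofRep (hq : qpow ℏ 1 ≠ qpow ℏ (-1)) (ρ : Uq ℏ →ₐ[ℂ] A)
    (hG : ∀ ε : ℤˣ, ρ (gen ℏ (.G ε)) = qpow ℏ (((ε : ℤ) : ℂ) * k / 2) • 1) :
    Currents ℏ k A where
  X ε i m := ρ (gen ℏ (.X ε i m))
  h i m := freeAct ρ (Free.h i m)
  K ε i := ρ (gen ℏ (.K ε i))
  p ε i := PowerSeries.mk
    (expTerm (PowerSeries.map (freeAct ρ).toRingHom (Free.psiExponent ℏ ε i)))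
  K_mul_K ε i := by
    have := freeAct_eq ρ (Rel.K_inv (ℏ := ℏ) ε i)
    rwa [map_mul, map_one] at this
  K_X ε' ε i j m := by
    have h1 := freeAct_eq ρ (Rel.K_X (ℏ := ℏ) ε i j m)
    have hK : ∀ ε, ρ (gen ℏ (.K ε i)) * ρ (gen ℏ (.K (-ε) i)) = 1 := fun ε => by
      have := freeAct_eq ρ (Rel.K_inv (ℏ := ℏ) ε i)
      rwa [map_mul, map_one] at this
    have hK1 := hK 1
    have hK2 := hK (-1)
    rw [neg_neg] at hK2
    rw [map_mul, map_mul, map_smul] at h1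
    change ρ (gen ℏ (.K 1 i)) * ρ (gen ℏ (.X ε j m)) * ρ (gen ℏ (.K (-1) i)) =
      _ • ρ (gen ℏ (.X ε j m)) at h1
    rcases Int.units_eq_one_or ε' with rfl | rfl
    · have h2 := congrArg (· * ρ (gen ℏ (.K 1 i))) h1
      simp only [mul_assoc, hK2, mul_one, smul_mul_assoc] at h2
      simpa using h2
    · have h2 := congrArg (ρ (gen ℏ (.K (-1) i)) * ·) h1
      simp only [← mul_assoc, hK2, one_mul, mul_smul_comm] at h2
      rw [h2, smul_smul, ← qpow_add]
      simp [qpow_zero]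
  h_X ε σ i j m hij := by
    have h := freeAct_eq ρ (Rel.h_X (ℏ := ℏ) ε i j σ m σ.ne_zero)
    rw [map_sub, map_mul, map_mul, map_smul, map_mul, freeAct_Gpow ρ hG, smul_one_mul,
      smul_smul] at h
    refine h.trans ?_
    have hij' : cartan i j = -1 := by cases i <;> cases j <;> first | rfl | exact absurd rfl hij
    have hc := sub_ne_zero.mpr hq
    have hn : ∀ x, qnum ℏ (-x) = -qnum ℏ x := fun x => by
      rw [qnum, qnum, neg_neg]; ring
    have h1 : qnum ℏ 1 = 1 := div_self hc
    congr 1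
    rw [hij']
    rcases Int.units_eq_one_or σ with rfl | rfl
    · simp [hn, h1]
    · simp [h1]
  p_zero ε i := by simp [expTerm]
  euler_p ε i := by
    have hH : PowerSeries.map (freeAct ρ).toRingHom (Free.psiExponent ℏ ε i) =
        PowerSeries.mk fun n => (((ε : ℤ) : ℂ) * (qpow ℏ 1 - qpow ℏ (-1))) •
          freeAct ρ (Free.h i ((ε : ℤ) * (n : ℤ))) := by
      ext n
      rw [PowerSeries.coeff_map, Free.psiExponent, PowerSeries.coeff_mk, PowerSeries.coeff_mk]
      exact map_smul (freeAct ρ) _ _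
    rw [hH]
    refine euler_expTerm _ (by simp [Free.h]) (commute_euler_of_coeff fun m n => ?_)
    rw [PowerSeries.coeff_mk, PowerSeries.coeff_mk]
    exact ((freeAct_h_commute ρ ε i m n).smul_left _).smul_right _
  X_X i m n := by
    have h := freeAct_eq ρ (Rel.X_X (ℏ := ℏ) i i m n)
    rw [if_pos rfl, qcomm, map_sub, map_smul, map_mul, map_mul, map_smul, map_sub, map_mul,
      map_mul, freeAct_Gpow ρ hG, freeAct_Gpow ρ hG, smul_one_mul, smul_one_mul, freeAct_psi,
      freeAct_psi] at h
    simp only [Units.val_one, one_mul, Units.val_neg, neg_one_mul, Left.nonneg_neg_iff,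
      PowerSeries.coeff_mk, Int.cast_neg] at h ⊢
    exact h
  X_X_ne i j m n hij := by
    have h := freeAct_eq ρ (Rel.X_X (ℏ := ℏ) i j m n)
    have hs : swapSign i j = 1 := by cases i <;> cases j <;> first | rfl | exact absurd rfl hij
    rw [if_neg hij, qcomm, hs, one_smul, map_sub, map_mul, map_mul, map_zero, sub_eq_zero] at h
    exact h

/-- The image of a system of currents under the involution `X^{±,i}_m ↦ X^{∓,i}_{-m}`,
`h^i_m ↦ -h^i_{-m}`, `q^{h^i_0} ↦ q^{-h^i_0}`, `c ↦ -c`, with the sign of `X^{+,2}` changed. -/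
def Currents.flip (C : Currents ℏ k A) : Currents ℏ (-k) A where
  X ε i m := (if i = .two then ((ε : ℤ) : ℂ) else 1) • C.X (-ε) i (-m)
  h i m := -C.h i (-m)
  K ε i := C.K (-ε) i
  p ε i := C.p (-ε) i
  K_mul_K ε i := C.K_mul_K (-ε) i
  K_X ε' ε i j m := by
    rw [mul_smul_comm, C.K_X, smul_mul_assoc, smul_comm]
    simp
  h_X ε σ i j m hij := by
    have h := C.h_X (-ε) (-σ) i j (-m) hij
    have e : -(m + (σ : ℤ)) = -m + ((-σ : ℤˣ) : ℤ) := by push_cast; ring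
    rw [e, mul_smul_comm, smul_mul_assoc, ← smul_sub, smul_comm, neg_mul, mul_neg,
      sub_neg_eq_add, neg_add_eq_sub, ← neg_sub, ← Units.val_neg, h, ← neg_smul]
    congr 2
    push_cast
    ring_nf
  p_zero ε i := C.p_zero (-ε) i
  euler_p ε i := by
    rw [C.euler_p]
    congr 2
    ext n
    rw [PowerSeries.coeff_mk, PowerSeries.coeff_mk]
    push_cast
    rw [neg_mul, neg_mul, neg_smul, smul_neg]
  X_X i m n := by
    have h := C.X_X i (-n) (-m)
    have e1 : ((-n - -m : ℤ) : ℂ) = ((m - n : ℤ) : ℂ) := by push_cast; ring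
    have e2 : -n + -m = -(m + n) := by ring
    rw [e1, e2] at h
    simp only [Left.nonneg_neg_iff, Left.neg_nonpos_iff, neg_neg] at h
    have e3 : -((m - n : ℤ) : ℂ) * -k / 2 = ((m - n : ℤ) : ℂ) * k / 2 := by ring
    have e4 : ((m - n : ℤ) : ℂ) * -k / 2 = -((m - n : ℤ) : ℂ) * k / 2 := by ring
    rw [e3, e4, neg_neg]
    cases i
    · simp only [swapSign, one_smul, reduceCtorEq, if_false] at h ⊢
      rw [← neg_sub, h, ← smul_neg, neg_sub]
    · simp only [swapSign, one_smul, neg_smul, if_true, neg_neg, Units.val_one, Units.val_neg,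
        Int.cast_one, Int.cast_neg, mul_neg, neg_mul, sub_neg_eq_add] at h ⊢
      rw [← neg_add', add_comm, h, ← smul_neg, neg_sub]
  X_X_ne i j m n hij := by
    have h := C.X_X_ne j i (-n) (-m) hij.symm
    simp only [neg_neg, mul_smul_comm, smul_mul_assoc]
    rw [h, smul_comm]

end OfRep

/-! ### Extremal components from the intertwining relations, and operators on formal series -/

section Relations

variable {ℏ k : ℂ} {A : Type*} [Ring A] [Algebra ℂ A] {C : Currents ℏ k A} {z : Aˣ}

theorem flip_X_one (ε : ℤˣ) (m : ℤ) : C.flip.X ε .one m = C.X (-ε) .one (-m) :=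
  one_smul _ _

theorem flip_X_two (ε : ℤˣ) (m : ℤ) :
    C.flip.X ε .two m = ((ε : ℤ) : ℂ) • C.X (-ε) .two (-m) := rfl

/-- The extremal relations for a component `F` of a vertex operator of type I. The hypotheses
`F_f` and `F_e` are the relations with the affine Chevalley generators `f_0` and `e_0`; `P` is the parity
operator, and `G₁`, `G₂` are the neighbouring components. -/
theorem isExtremal_of_typeI {a b u v w e₁ e₂ : ℂ} {F G₁ G₂ P : A}
    (z_X : ∀ ε i m, Commute (z : A) (C.X ε i m)) (z_h : ∀ i m, m ≠ 0 → Commute (z : A) (C.h i m))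
    (z_K : ∀ ε i, Commute (z : A) (C.K ε i)) (z_P : Commute (z : A) P)
    (P_X : Commute P (C.X 1 .one 0)) (P_K : ∀ ε i, Commute P (C.K ε i))
    (F_X : ∀ i, Commute F (C.X 1 i 0)) (F_Y : Commute F (C.X (-1) .one 0))
    (F_K_one : Commute F (C.K 1 .one))
    (F_K_two : F * C.K 1 .two = qpow ℏ a • (C.K 1 .two * F))
    (F_f : F * (C.K 1 .one * C.K 1 .two * (C.X 1 .one (-1) * C.X 1 .two 0 -
        qpow ℏ 1 • (C.X 1 .two 0 * C.X 1 .one (-1)))) =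
      qpow ℏ a • (C.K 1 .one * C.K 1 .two * (C.X 1 .one (-1) * C.X 1 .two 0 -
        qpow ℏ 1 • (C.X 1 .two 0 * C.X 1 .one (-1))) * F))
    (F_Y_two : F * C.X (-1) .two 0 = qpow ℏ (-a) • (C.X (-1) .two 0 * F) + u • (P * G₁))
    (F_e : F * -((C.X (-1) .two 0 * C.X (-1) .one 1 -
        qpow ℏ (-1) • (C.X (-1) .one 1 * C.X (-1) .two 0)) * C.K (-1) .one * C.K (-1) .two) =
      -((C.X (-1) .two 0 * C.X (-1) .one 1 -
        qpow ℏ (-1) • (C.X (-1) .one 1 * C.X (-1) .two 0)) * C.K (-1) .one * C.K (-1) .two) * F +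
      (v * qpow ℏ k) • (C.K (-1) .one * C.K (-1) .two * P * z * G₂))
    (G_K_one : G₂ * C.K (-1) .one = qpow ℏ (-e₁) • (C.K (-1) .one * G₂))
    (G_K_two : G₂ * C.K (-1) .two = qpow ℏ (-e₂) • (C.K (-1) .two * G₂))
    (he : e₁ + e₂ = a)
    (G_X : G₂ * C.X 1 .one 0 = C.X 1 .one 0 * G₂ + w • (C.K 1 .one * G₁))
    (huv : -(v * w) = qpow ℏ (b - 1) * u) :
    IsExtremal C z a b F (u • (P * G₁)) ((-(v * qpow ℏ (k + a))) • (P * G₂)) := by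
  refine ⟨z_X, z_h, z_K, F_X, F_Y, F_K_one, F_K_two, ?_, ?_, ?_, ?_⟩
  · have e1 := congrArg (C.K 1 .one * ·) F_K_two
    have hu := (C.isUnit_K 1 .one).mul (C.isUnit_K 1 .two)
    generalize C.X 1 .one (-1) * C.X 1 .two 0 -
      qpow ℏ 1 • (C.X 1 .two 0 * C.X 1 .one (-1)) = E at *
    refine hu.mul_left_cancel (smul_right_injective A (qpow_ne_zero ℏ a) ?_)
    simp only [← mul_assoc, mul_smul_comm] at F_f e1 ⊢
    rw [← F_f, F_K_one.eq, e1, smul_mul_assoc]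
  · rw [F_Y_two, add_sub_cancel_left]
  · generalize C.X (-1) .two 0 * C.X (-1) .one 1 -
      qpow ℏ (-1) • (C.X (-1) .one 1 * C.X (-1) .two 0) = W at *
    have hu := (C.isUnit_K (-1) .one).mul (C.isUnit_K (-1) .two)
    refine hu.mul_right_cancel ?_
    have hg : qpow ℏ (k + a) = qpow ℏ k * qpow ℏ a := qpow_add _ _ _
    have hge : qpow ℏ (-e₁) * qpow ℏ (-e₂) = qpow ℏ (-a) := by
      rw [← qpow_add, ← he]; congr 1; ring
    have hl := qpow_mul_qpow_neg ℏ a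
    rw [hg]
    have f1 := congrArg (fun x => W * (x * C.K (-1) .two)) (C.commute_K_inv F_K_one).eq
    have f2 := congrArg (fun x => W * (C.K (-1) .one * x)) (C.mul_K_inv F_K_two)
    have g1 := congrArg (fun x => (z : A) * (P * (x * C.K (-1) .two))) G_K_one
    have g2 := congrArg (fun x => (z : A) * (P * (C.K (-1) .one * x))) G_K_two
    have p1 : C.K (-1) .one * C.K (-1) .two * P * z * G₂ =
        z * (P * (C.K (-1) .one * (C.K (-1) .two * G₂))) := by
      rw [mul_assoc _ P, ← z_P.eq, mul_assoc (C.K (-1) .one), ← mul_assoc (C.K (-1) .two),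
        ← (z_K (-1) .two).eq, mul_assoc (z : A), ← (P_K (-1) .two).eq, ← mul_assoc (C.K (-1) .one),
        ← (z_K (-1) .one).eq, mul_assoc (z : A), ← mul_assoc (C.K (-1) .one),
        ← (P_K (-1) .one).eq]
      simp only [mul_assoc]
    rw [p1] at F_e
    generalize qpow ℏ (-e₁) = E₁ at *
    generalize qpow ℏ (-e₂) = E₂ at *
    generalize qpow ℏ (-a) = l' at *
    generalize qpow ℏ a = l at *
    generalize qpow ℏ k = κ at *
    simp only [mul_assoc, sub_mul, neg_mul, mul_neg, mul_smul_comm, smul_mul_assoc, neg_smul]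
      at F_e f1 f2 g1 g2 ⊢
    linear_combination (norm := module) -F_e - l • f1 - l • f2 + (v * κ * l) • g1
      + (v * κ * l * E₁) • g2
      + (v * κ * l) • hge • (z * (P * (C.K (-1) .one * (C.K (-1) .two * G₂))))
      - hl • (W * (C.K (-1) .one * (C.K (-1) .two * F)))
      + (v * κ) • hl • (z * (P * (C.K (-1) .one * (C.K (-1) .two * G₂))))
  · have hg : qpow ℏ (a + k + b - 1) = qpow ℏ (k + a) * qpow ℏ (b - 1) := by
      rw [← qpow_add]; congr 1; ring
    have e1 := congrArg (P * ·) G_X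
    have e2 := congrArg (· * G₂) P_X.eq
    have e3 := congrArg (· * G₁) (P_K 1 .one).eq
    rw [hg]
    generalize qpow ℏ (k + a) = κ at *
    simp only [mul_assoc, mul_add, mul_smul_comm, smul_mul_assoc] at e1 e2 e3 ⊢
    linear_combination (norm := module) (-(v * κ)) • e1 - (v * κ) • e2 - (v * κ * w) • e3
      + (κ * huv) • (C.K 1 .one * (P * G₁))

/-- The extremal relations for a component `F` of a vertex operator of type II; they hold after the
involution `Currents.flip`, which exchanges the roles of `e_0` and `f_0` and inverts `z`. -/
theorem isExtremal_of_typeII {a b u v w : ℂ} {F G₁ G₂ : A}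
    (z_X : ∀ ε i m, Commute (z : A) (C.X ε i m)) (z_h : ∀ i m, m ≠ 0 → Commute (z : A) (C.h i m))
    (z_K : ∀ ε i, Commute (z : A) (C.K ε i))
    (F_X : ∀ i, Commute F (C.X (-1) i 0)) (F_Y : Commute F (C.X 1 .one 0))
    (F_K_one : Commute F (C.K (-1) .one))
    (F_K_two : F * C.K (-1) .two = qpow ℏ a • (C.K (-1) .two * F))
    (F_e : F * -((C.X (-1) .two 0 * C.X (-1) .one 1 -
        qpow ℏ (-1) • (C.X (-1) .one 1 * C.X (-1) .two 0)) * C.K (-1) .one * C.K (-1) .two) =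
      qpow ℏ a • (-((C.X (-1) .two 0 * C.X (-1) .one 1 -
        qpow ℏ (-1) • (C.X (-1) .one 1 * C.X (-1) .two 0)) * C.K (-1) .one * C.K (-1) .two) * F))
    (F_X_two : F * C.X 1 .two 0 = -u • G₁ + qpow ℏ (-a) • (C.X 1 .two 0 * F))
    (F_f : F * (C.K 1 .one * C.K 1 .two * (C.X 1 .one (-1) * C.X 1 .two 0 -
        qpow ℏ 1 • (C.X 1 .two 0 * C.X 1 .one (-1)))) =
      (v * qpow ℏ (-k)) • (C.K 1 .one * C.K 1 .two * (↑z⁻¹ : A) * G₂) +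
      C.K 1 .one * C.K 1 .two * (C.X 1 .one (-1) * C.X 1 .two 0 -
        qpow ℏ 1 • (C.X 1 .two 0 * C.X 1 .one (-1))) * F)
    (G_X : G₂ * C.X (-1) .one 0 = w • (C.K (-1) .one * G₁) + C.X (-1) .one 0 * G₂)
    (huv : v * w = qpow ℏ b * u) :
    IsExtremal C.flip z⁻¹ a b F (u • G₁) ((v * qpow ℏ (-k + a - 1)) • G₂) := by
  refine ⟨fun ε i m => ((z_X _ _ _).units_inv_left).smul_right _,
    fun i m hm => ((z_h _ _ (neg_ne_zero.mpr hm)).units_inv_left).neg_right,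
    fun ε i => (z_K _ _).units_inv_left, fun i => ?_, ?_, F_K_one, F_K_two, ?_, ?_, ?_, ?_⟩
  · exact (F_X i).smul_right _
  · rw [flip_X_one]; exact F_Y
  · rw [flip_X_one, flip_X_two]
    simp only [Units.val_one, Int.cast_one, one_smul, neg_neg, neg_zero]
    have e1 := congrArg (· * C.K (-1) .two) F_K_one.eq
    have e2 := congrArg (C.K (-1) .one * ·) F_K_two
    have hq1 := qpow_mul_qpow_neg ℏ 1
    have hu := (C.isUnit_K (-1) .one).mul (C.isUnit_K (-1) .two)
    have hW : C.X (-1) .one 1 * C.X (-1) .two 0 - qpow ℏ 1 • (C.X (-1) .two 0 * C.X (-1) .one 1) =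
        (-qpow ℏ 1) • (C.X (-1) .two 0 * C.X (-1) .one 1 -
          qpow ℏ (-1) • (C.X (-1) .one 1 * C.X (-1) .two 0)) := by
      linear_combination (norm := module) -hq1 • (C.X (-1) .one 1 * C.X (-1) .two 0)
    rw [hW]
    generalize C.X (-1) .two 0 * C.X (-1) .one 1 -
      qpow ℏ (-1) • (C.X (-1) .one 1 * C.X (-1) .two 0) = W at *
    refine Commute.smul_right (hu.mul_right_cancel ?_) _
    have f1 := congrArg (W * ·) e1
    have f2 := congrArg (W * ·) e2
    simp only [mul_assoc, mul_neg, neg_mul, mul_smul_comm, smul_neg] at F_e f1 f2 ⊢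
    linear_combination (norm := module) -F_e - f1 - f2
  · rw [flip_X_two]
    simp only [Units.val_neg, Units.val_one, Int.cast_neg, Int.cast_one, neg_smul, one_smul,
      neg_neg, neg_zero, mul_neg, neg_mul, smul_neg, F_X_two]
    module
  · rw [flip_X_one, flip_X_two]
    simp only [Units.val_neg, Units.val_one, Int.cast_neg, Int.cast_one, neg_smul, one_smul,
      neg_neg, neg_zero, mul_neg, neg_mul]
    have hq1 := qpow_mul_qpow_neg ℏ 1
    have hW : -(C.X 1 .two 0 * C.X 1 .one (-1)) - qpow ℏ (-1) • -(C.X 1 .one (-1) * C.X 1 .two 0) =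
        qpow ℏ (-1) • (C.X 1 .one (-1) * C.X 1 .two 0 -
          qpow ℏ 1 • (C.X 1 .two 0 * C.X 1 .one (-1))) := by
      linear_combination (norm := module) hq1 • (C.X 1 .two 0 * C.X 1 .one (-1))
    have hg : qpow ℏ (-k + a - 1) = qpow ℏ (-k) * qpow ℏ a * qpow ℏ (-1) := by
      rw [← qpow_add, ← qpow_add]; congr 1
    have hl := qpow_mul_qpow_neg ℏ a
    have hu := (C.isUnit_K 1 .one).mul (C.isUnit_K 1 .two)
    rw [hW, hg]
    generalize C.X 1 .one (-1) * C.X 1 .two 0 -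
      qpow ℏ 1 • (C.X 1 .two 0 * C.X 1 .one (-1)) = E at *
    refine hu.mul_left_cancel ?_
    have e1 := congrArg (fun x => x * C.K 1 .two * E) (C.commute_K_inv F_K_one).eq
    have e2 := congrArg (fun x => C.K 1 .one * x * E) (C.mul_K_inv F_K_two)
    simp only [neg_neg] at e1 e2
    generalize qpow ℏ (-a) = l' at *
    generalize qpow ℏ a = l at *
    generalize qpow ℏ (-k) = κ at *
    generalize qpow ℏ (-1) = q' at *
    simp only [mul_assoc, mul_sub, mul_smul_comm, smul_mul_assoc] at F_f e1 e2 ⊢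
    linear_combination (norm := module) (l * q') • F_f - (l * q') • e1 - (l * q') • e2
      - q' • hl • (C.K 1 .one * (C.K 1 .two * (F * E)))
  · rw [flip_X_one]
    simp only [neg_zero]
    have hg : qpow ℏ (a + -k + b - 1) = qpow ℏ (-k + a - 1) * qpow ℏ b := by
      rw [← qpow_add]; congr 1; ring
    rw [hg, smul_mul_assoc, mul_smul_comm, G_X]
    change _ = _ • (C.K (-1) .one * _)
    rw [mul_smul_comm]
    generalize qpow ℏ (-k + a - 1) = κ
    linear_combination (norm := module) (κ * huv) • (C.K (-1) .one * G₁)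

end Relations

section Operators

variable {ℏ k : ℂ} {M N : Type*} [AddCommGroup M] [Module ℂ M] [AddCommGroup N] [Module ℂ N]

/-- The space `M ⊕ N[[z, z⁻¹]]`, on which `U_q[sl(2|1)^]`, the variable `z` and the components of
vertex operators `M → N[[z, z⁻¹]]` all act. -/
abbrev Series (M N : Type*) : Type _ := M × (ℤ → N)

/-- The action on formal series by the action on the coefficients. -/
def coeffwise : Module.End ℂ N →ₐ[ℂ] Module.End ℂ (ℤ → N) where
  toFun T := T.compLeft ℤ
  map_one' := rfl
  map_mul' _ _ := rfl
  map_zero' := rfl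
  map_add' _ _ := rfl
  commutes' _ := rfl

@[simp]
theorem coeffwise_apply (T : Module.End ℂ N) (f : ℤ → N) (n : ℤ) :
    coeffwise T f n = T (f n) := rfl

/-- The action of `U_q[sl(2|1)^]` on `M ⊕ N[[z, z⁻¹]]`. -/
def seriesAct (L : LevelModule ℏ k M) (R : LevelModule ℏ k N) :
    Uq ℏ →ₐ[ℂ] Module.End ℂ (Series M N) :=
  (LinearMap.prodMapAlgHom ℂ M (ℤ → N)).comp (L.act.prod (coeffwise.comp R.act))

/-- The parity operator of `M ⊕ N[[z, z⁻¹]]`. -/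
def seriesParity (L : LevelModule ℏ k M) (R : LevelModule ℏ k N) :
    Module.End ℂ (Series M N) :=
  LinearMap.prodMap L.P (coeffwise R.P)

/-- Multiplication by `z^l` on `M ⊕ N[[z, z⁻¹]]`, trivial on `M`. -/
def mulZPow (M N : Type*) [AddCommGroup M] [Module ℂ M] [AddCommGroup N] [Module ℂ N] (l : ℤ) :
    Module.End ℂ (Series M N) :=
  LinearMap.prodMap 1 (LinearMap.funLeft ℂ N fun n => n - l)

/-- Multiplication by `z` as a unit. -/
def mulZ (M N : Type*) [AddCommGroup M] [Module ℂ M] [AddCommGroup N] [Module ℂ N] :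
    (Module.End ℂ (Series M N))ˣ where
  val := mulZPow M N 1
  inv := mulZPow M N (-1)
  val_inv := by
    ext <;> simp [mulZPow, LinearMap.funLeft]
  inv_val := by
    ext <;> simp [mulZPow, LinearMap.funLeft]

/-- The series `F(z) = ∑ F_n z^n` of operators `M → N` as an operator on `M ⊕ N[[z, z⁻¹]]`. -/
def seriesOp : (ℤ → M →ₗ[ℂ] N) →ₗ[ℂ] Module.End ℂ (Series M N) where
  toFun F := LinearMap.inr ℂ M (ℤ → N) ∘ₗ LinearMap.pi F ∘ₗ LinearMap.fst ℂ M (ℤ → N)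
  map_add' _ _ := by ext <;> simp
  map_smul' _ _ := by ext <;> simp

theorem seriesOp_injective : Function.Injective (seriesOp (M := M) (N := N)) := by
  intro F G h
  ext n m
  have := congrArg (fun T : Module.End ℂ (Series M N) => (T (m, 0)).2 n) h
  simpa [seriesOp] using this

variable (L : LevelModule ℏ k M) (R : LevelModule ℏ k N)

theorem seriesOp_mul_act (F : ℤ → M →ₗ[ℂ] N) (x : Uq ℏ) :
    seriesOp F * seriesAct L R x = seriesOp fun n => F n ∘ₗ L.act x := by
  ext <;> simp [seriesOp, seriesAct]

theorem act_mul_seriesOp (F : ℤ → M →ₗ[ℂ] N) (x : Uq ℏ) :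
    seriesAct L R x * seriesOp F = seriesOp fun n => R.act x ∘ₗ F n := by
  ext <;> simp [seriesOp, seriesAct]

theorem parity_mul_seriesOp (F : ℤ → M →ₗ[ℂ] N) :
    seriesParity L R * seriesOp F = seriesOp fun n => R.P ∘ₗ F n := by
  ext <;> simp [seriesOp, seriesParity]

theorem mulZPow_mul_seriesOp (F : ℤ → M →ₗ[ℂ] N) (l : ℤ) :
    mulZPow M N l * seriesOp F = seriesOp fun n => F (n - l) := by
  ext <;> simp [seriesOp, mulZPow, LinearMap.funLeft]

theorem mulZPow_add (l l' : ℤ) : mulZPow M N (l + l') = mulZPow M N l * mulZPow M N l' := by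
  ext <;> simp [mulZPow, LinearMap.funLeft, sub_sub]

theorem mulZPow_zero : mulZPow M N 0 = 1 := by
  ext <;> simp [mulZPow, LinearMap.funLeft]

theorem mulZ_pow (n : ℕ) : (mulZ M N : Module.End ℂ (Series M N)) ^ n = mulZPow M N n := by
  induction n with
  | zero => simp [mulZPow_zero]
  | succ n ih => rw [pow_succ, ih, Nat.cast_succ, mulZPow_add]; rfl

theorem mulZ_inv_pow (n : ℕ) :
    (↑(mulZ M N)⁻¹ : Module.End ℂ (Series M N)) ^ n = mulZPow M N (-n) := by
  induction n with
  | zero => simp [mulZPow_zero]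
  | succ n ih => rw [pow_succ, ih, Nat.cast_succ, neg_add, mulZPow_add]; rfl

theorem mulZ_commute_act (x : Uq ℏ) :
    Commute (mulZ M N : Module.End ℂ (Series M N)) (seriesAct L R x) := by
  rw [commute_iff_eq]
  ext <;> simp [mulZ, mulZPow, seriesAct, LinearMap.funLeft]

theorem mulZ_commute_parity :
    Commute (mulZ M N : Module.End ℂ (Series M N)) (seriesParity L R) := by
  rw [commute_iff_eq]
  ext <;> simp [mulZ, mulZPow, seriesParity, LinearMap.funLeft]

theorem parity_commute_act (g : Gen) (hg : g.odd = false) :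
    Commute (seriesParity L R) (seriesAct L R (gen ℏ g)) := by
  have hL := L.even_comm g hg
  have hR := R.even_comm g hg
  refine LinearMap.ext fun x => Prod.ext ?_ (funext fun n => ?_)
  · exact LinearMap.congr_fun hL x.1
  · exact LinearMap.congr_fun hR (x.2 n)

theorem seriesAct_G (ε : ℤˣ) :
    seriesAct L R (gen ℏ (.G ε)) = qpow ℏ (((ε : ℤ) : ℂ) * k / 2) • 1 := by
  refine LinearMap.ext fun x => Prod.ext ?_ (funext fun n => ?_)
  · exact LinearMap.congr_fun (L.level ε) x.1
  · exact LinearMap.congr_fun (R.level ε) (x.2 n)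

end Operators

/-! ### Components of vertex operators -/

theorem commutator_h_of_flip {ℏ k : ℂ} {A : Type*} [Ring A] [Algebra ℂ A] (C : Currents ℏ k A)
    {F w : A} {i : Node} {m : ℤ} {c : ℂ}
    (h : C.flip.h i (-m) * F - F * C.flip.h i (-m) = c • w) :
    C.h i m * F - F * C.h i m = (-c) • w := by
  simp only [Currents.flip, neg_neg] at h
  rw [neg_smul, ← h]
  noncomm_ring

section Operators

variable {ℏ k : ℂ} {M N : Type*} [AddCommGroup M] [Module ℂ M] [AddCommGroup N] [Module ℂ N]
variable (L : LevelModule ℏ k M) (R : LevelModule ℏ k N)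

theorem compI_map (T : Module.End ℂ N) (B : Matrix (Fin 4) (Fin 4) ℂ)
    (Φ : ℤ → M →ₗ[ℂ] N ⊗[ℂ] V4) (r : Fin 4) (n : ℤ) :
    (TensorProduct.rid ℂ N).toLinearMap ∘ₗ TensorProduct.map LinearMap.id (LinearMap.proj r) ∘ₗ
      TensorProduct.map T (Matrix.toLin' B) ∘ₗ Φ n = ∑ s, B r s • T ∘ₗ compI Φ s n := by
  ext m
  simp only [compI, LinearMap.comp_apply, LinearMap.sum_apply, LinearMap.smul_apply]
  induction Φ n m using TensorProduct.induction_on with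
  | zero => simp
  | tmul x v =>
    simp [Matrix.mulVec, dotProduct, Finset.sum_smul, smul_smul]
  | add x y hx hy => simp only [map_add, hx, hy, smul_add, Finset.sum_add_distrib]

theorem compII_map (T : Module.End ℂ N) (B : Matrix (Fin 4) (Fin 4) ℂ)
    (Ψ : ℤ → M →ₗ[ℂ] V4 ⊗[ℂ] N) (r : Fin 4) (n : ℤ) :
    (TensorProduct.lid ℂ N).toLinearMap ∘ₗ TensorProduct.map (LinearMap.proj r) LinearMap.id ∘ₗ
      TensorProduct.map (Matrix.toLin' B) T ∘ₗ Ψ n = ∑ s, B r s • T ∘ₗ compII Ψ s n := by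
  ext m
  simp only [compII, LinearMap.comp_apply, LinearMap.sum_apply, LinearMap.smul_apply]
  induction Ψ n m using TensorProduct.induction_on with
  | zero => simp
  | tmul v x =>
    simp [Matrix.mulVec, dotProduct, Finset.sum_smul, smul_smul]
  | add x y hx hy => simp only [map_add, hx, hy, smul_add, Finset.sum_add_distrib]

/-- The action of a Chevalley generator, or of `1`, on `M ⊕ N[[z, z⁻¹]]`. -/
def seriesChev : Option Chev → Module.End ℂ (Series M N)
  | some x => seriesAct L R (chev ℏ x)
  | none => 1

theorem seriesChev_mul_seriesOp (x : Option Chev) (F : ℤ → M →ₗ[ℂ] N) :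
    seriesChev L R x * seriesOp F = seriesOp fun n => R.chevAct x ∘ₗ F n := by
  cases x with
  | some x => exact act_mul_seriesOp L R F _
  | none => exact one_mul _

theorem parity_pow_mul_seriesOp (j : ℕ) (F : ℤ → M →ₗ[ℂ] N) :
    seriesParity L R ^ j * seriesOp F = seriesOp fun n => (R.P ^ j) ∘ₗ F n := by
  induction j with
  | zero => rw [pow_zero, one_mul]; rfl
  | succ j ih =>
    rw [pow_succ', mul_assoc, ih, parity_mul_seriesOp]
    congr 1
    funext n
    rw [pow_succ']
    rfl

/-- The intertwining property of a vertex operator of type I in terms of its components. -/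
theorem IsTypeI.component_mul {π : Option Chev → Matrix (Fin 4) (Fin 4) ℂ}
    {Φ : ℤ → M →ₗ[ℂ] N ⊗[ℂ] V4} (hΦ : IsTypeI L R π Φ) (x : Chev) (r : Fin 4) :
    seriesOp (compI Φ r) * seriesAct L R (chev ℏ x) =
      ((coproduct x).map fun ab => ∑ s, π ab.2 r s •
        (seriesChev L R ab.1 * (seriesParity L R ^ par ab.2 *
          (mulZPow M N (zdeg ab.2) * seriesOp (compI Φ s))))).sum := by
  have h : ∀ n, compI Φ r n ∘ₗ L.act (chev ℏ x) = ((coproduct x).map fun ab => ∑ s, π ab.2 r s •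
      (R.chevAct ab.1 * R.P ^ par ab.2) ∘ₗ compI Φ s (n - zdeg ab.2)).sum := fun n => by
    rw [compI, LinearMap.comp_assoc, LinearMap.comp_assoc, hΦ.intertwines]
    cases x <;> simp only [coproduct, List.map_cons, List.map_nil, List.sum_cons, List.sum_nil,
      add_zero, LinearMap.comp_add, compI_map]
  simp only [mulZPow_mul_seriesOp, parity_pow_mul_seriesOp, seriesChev_mul_seriesOp, ← map_smul,
    ← map_sum]
  rw [seriesOp_mul_act, funext h]
  cases x <;> simp only [coproduct, List.map_cons, List.map_nil, List.sum_cons, List.sum_nil,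
    add_zero, ← map_add] <;> rfl

/-- The intertwining property of a vertex operator of type II in terms of its components. -/
theorem IsTypeII.component_mul {π : Option Chev → Matrix (Fin 4) (Fin 4) ℂ}
    {Ψ : ℤ → M →ₗ[ℂ] V4 ⊗[ℂ] N} (hΨ : IsTypeII L R π Ψ) (x : Chev) (r : Fin 4) :
    seriesOp (compII Ψ r) * seriesAct L R (chev ℏ x) =
      ((coproduct x).map fun ab => ∑ s, (π ab.1 * parV ^ par ab.2) r s •
        (seriesChev L R ab.2 * (mulZPow M N (zdeg ab.1) * seriesOp (compII Ψ s)))).sum := by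
  have h : ∀ n, compII Ψ r n ∘ₗ L.act (chev ℏ x) = ((coproduct x).map fun ab =>
      ∑ s, (π ab.1 * parV ^ par ab.2) r s •
        R.chevAct ab.2 ∘ₗ compII Ψ s (n - zdeg ab.1)).sum := fun n => by
    rw [compII, LinearMap.comp_assoc, LinearMap.comp_assoc, hΨ.intertwines]
    cases x <;> simp only [coproduct, List.map_cons, List.map_nil, List.sum_cons, List.sum_nil,
      add_zero, LinearMap.comp_add, compII_map]
  simp only [mulZPow_mul_seriesOp, seriesChev_mul_seriesOp, ← map_smul, ← map_sum]
  rw [seriesOp_mul_act, funext h]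
  cases x <;> simp only [coproduct, List.map_cons, List.map_nil, List.sum_cons, List.sum_nil,
    add_zero, ← map_add] <;> rfl

/-- The currents acting on `M ⊕ N[[z, z⁻¹]]`. -/
def seriesCurrents (hq : qpow ℏ 1 ≠ qpow ℏ (-1)) : Currents ℏ k (Module.End ℂ (Series M N)) :=
  Currents.ofRep hq (seriesAct L R) (seriesAct_G L R)

variable (hq : qpow ℏ 1 ≠ qpow ℏ (-1))

theorem seriesCurrents_h (i : Node) (m : ℤ) (hm : m ≠ 0) :
    (seriesCurrents L R hq).h i m = seriesAct L R (gen ℏ (.h i m hm)) := by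
  change freeAct _ (Free.h i m) = _
  rw [Free.h, dif_pos hm]; rfl

theorem seriesAct_commutator {F : ℤ → M →ₗ[ℂ] N} {i : Node} {l : ℤ} {hl : l ≠ 0} {c : ℂ}
    (h : seriesAct L R (gen ℏ (.h i l hl)) * seriesOp F -
      seriesOp F * seriesAct L R (gen ℏ (.h i l hl)) = c • (mulZPow M N l * seriesOp F)) :
    HCommutator L R F i l hl c := by
  rw [act_mul_seriesOp, seriesOp_mul_act, mulZPow_mul_seriesOp, ← map_sub, ← map_smul] at h
  exact fun n => congrFun (seriesOp_injective h) n

theorem seriesAct_commutesWithX {F : ℤ → M →ₗ[ℂ] N} {ε : ℤˣ} {i : Node}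
    (h : ∀ m, Commute (seriesOp F) (seriesAct L R (gen ℏ (.X ε i m)))) :
    CommutesWithX L R F ε i := fun m n => by
  have h := (h m).eq
  rw [act_mul_seriesOp, seriesOp_mul_act] at h
  exact congrFun (seriesOp_injective h) n

theorem seriesAct_hasWeight {F : ℤ → M →ₗ[ℂ] N} {i : Node} {x : ℂ}
    (h : seriesAct L R (gen ℏ (.K 1 i)) * (seriesOp F * seriesAct L R (gen ℏ (.K (-1) i))) =
      qpow ℏ x • seriesOp F) :
    HasWeight L R F i x := fun n => by
  rw [seriesOp_mul_act, act_mul_seriesOp, ← map_smul] at h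
  exact congrFun (seriesOp_injective h) n

/-- The relations of an extremal component with the algebra, in terms of the coefficients
of `z^n`. -/
theorem typeI_properties {F : ℤ → M →ₗ[ℂ] N} {F₁ F₂ : Module.End ℂ (Series M N)} {a b : ℂ}
    (hE : IsExtremal (seriesCurrents L R hq) (mulZ M N) a b (seriesOp F) F₁ F₂) (i : Node) :
    CommutesWithX L R F 1 i ∧ HasWeight L R F i (-a * deltaTwo i) ∧
      ∀ (n : ℤ) (hn : 0 < n),
        HCommutator L R F i n hn.ne'
          (-deltaTwo i * qpow ℏ ((b + 3 / 2 * k) * n) * (qnum ℏ (a * n) / n)) ∧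
        HCommutator L R F i (-n) (neg_ne_zero.mpr hn.ne')
          (-deltaTwo i * qpow ℏ (-(b + 1 / 2 * k) * n) * (qnum ℏ (a * n) / n)) := by
  refine ⟨seriesAct_commutesWithX L R (hE.commute_X hq i), seriesAct_hasWeight L R ?_,
    fun n hn => ?_⟩
  · change (seriesCurrents L R hq).K 1 i * (_ * (seriesCurrents L R hq).K (-1) i) = _
    cases i with
    | one =>
      rw [((seriesCurrents L R hq).commute_K_inv hE.F_K_one).eq, ← mul_assoc, Currents.K_mul_K]
      simp [deltaTwo, qpow_zero]
    | two =>
      rw [Currents.mul_K_inv _ hE.F_K_two, mul_smul_comm, ← mul_assoc, Currents.K_mul_K]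
      simp [deltaTwo]
  · obtain ⟨m, rfl⟩ := Int.eq_ofNat_of_zero_le hn.le
    have hm : 0 < m := by exact_mod_cast hn
    refine ⟨seriesAct_commutator L R ?_, seriesAct_commutator L R ?_⟩
    · rw [← seriesCurrents_h L R hq]
      cases i with
      | one =>
        have := hE.commute_h_one hq 1 m hm
        rw [Units.val_one, one_mul] at this
        rw [this.eq, sub_self]
        simp [deltaTwo]
      | two =>
        rw [hE.commutator_h_two_pos hq m hm, mulZ_pow]
        congr 1
        simp only [deltaTwo, Int.cast_natCast]
        ring
    · rw [← seriesCurrents_h L R hq]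
      cases i with
      | one =>
        have := hE.commute_h_one hq (-1) m hm
        rw [Units.val_neg, Units.val_one, neg_one_mul] at this
        rw [this.eq, sub_self]
        simp [deltaTwo]
      | two =>
        rw [hE.commutator_h_two_neg hq m hm, mulZ_inv_pow]
        congr 1
        simp only [deltaTwo, Int.cast_natCast]
        ring

/-- The relations of a component which is extremal after the involution `Currents.flip`. -/
theorem typeII_properties {F : ℤ → M →ₗ[ℂ] N} {F₁ F₂ : Module.End ℂ (Series M N)} {a b : ℂ}
    (hE : IsExtremal (seriesCurrents L R hq).flip (mulZ M N)⁻¹ a b (seriesOp F) F₁ F₂)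
    (i : Node) :
    CommutesWithX L R F (-1) i ∧ HasWeight L R F i (a * deltaTwo i) ∧
      ∀ (n : ℤ) (hn : 0 < n),
        HCommutator L R F i n hn.ne'
          (deltaTwo i * qpow ℏ ((1 / 2 * k - b) * n) * (qnum ℏ (a * n) / n)) ∧
        HCommutator L R F i (-n) (neg_ne_zero.mpr hn.ne')
          (deltaTwo i * qpow ℏ ((-(3 / 2) * k + b) * n) * (qnum ℏ (a * n) / n)) := by
  refine ⟨seriesAct_commutesWithX L R fun m => ?_, seriesAct_hasWeight L R ?_, fun n hn => ?_⟩
  · have h := hE.commute_X hq i (-m)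
    change Commute _ (_ • (seriesCurrents L R hq).X (-1) i (- -m)) at h
    rw [neg_neg, Units.val_one, Int.cast_one, ite_self, one_smul] at h
    exact h
  · change (seriesCurrents L R hq).flip.K (-1) i * (_ * (seriesCurrents L R hq).flip.K 1 i) = _
    have hK := fun i => (seriesCurrents L R hq).flip.K_mul_K (-1) i
    simp only [neg_neg] at hK
    cases i with
    | one =>
      rw [hE.F_K_one.eq, ← mul_assoc, hK]
      simp [deltaTwo, qpow_zero]
    | two =>
      rw [hE.F_K_two, mul_smul_comm, ← mul_assoc, hK]
      simp [deltaTwo]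
  · obtain ⟨m, rfl⟩ := Int.eq_ofNat_of_zero_le hn.le
    have hm : 0 < m := by exact_mod_cast hn
    refine ⟨seriesAct_commutator L R ?_, seriesAct_commutator L R ?_⟩
    · rw [← seriesCurrents_h L R hq]
      cases i with
      | one =>
        have := hE.commute_h_one hq (-1) m hm
        rw [Units.val_neg, Units.val_one, neg_one_mul] at this
        refine (commutator_h_of_flip _ (c := 0) (w := 0) ?_).trans ?_
        · rw [this.eq, sub_self, smul_zero]
        · simp [deltaTwo]
      | two =>
        refine (commutator_h_of_flip _ (hE.commutator_h_two_neg hq m hm)).trans ?_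
        rw [inv_inv, mulZ_pow, neg_neg]
        simp only [deltaTwo, one_mul, Int.cast_natCast]
        ring_nf
    · rw [← seriesCurrents_h L R hq]
      cases i with
      | one =>
        have := hE.commute_h_one hq 1 m hm
        rw [Units.val_one, one_mul] at this
        refine (commutator_h_of_flip _ (c := 0) (w := 0) ?_).trans ?_
        · rw [neg_neg, this.eq, sub_self, smul_zero]
        · simp [deltaTwo]
      | two =>
        refine (commutator_h_of_flip _ (m := -(m : ℤ)) (by
          rw [neg_neg]; exact hE.commutator_h_two_pos hq m hm)).trans ?_
        rw [mulZ_inv_pow, neg_neg]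
        simp only [deltaTwo, one_mul, Int.cast_natCast]
        ring_nf

end Operators

/-! ### The four vertex operators on the evaluation modules -/

section Evaluation

variable {ℏ k : ℂ} {M N : Type*} [AddCommGroup M] [Module ℂ M] [AddCommGroup N] [Module ℂ N]
variable (L : LevelModule ℏ k M) (R : LevelModule ℏ k N) (hq : qpow ℏ 1 ≠ qpow ℏ (-1))

theorem seriesCurrents_X (ε : ℤˣ) (i : Node) (m : ℤ) :
    (seriesCurrents L R hq).X ε i m = seriesAct L R (gen ℏ (.X ε i m)) := rfl

theorem seriesCurrents_K (ε : ℤˣ) (i : Node) :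
    (seriesCurrents L R hq).K ε i = seriesAct L R (gen ℏ (.K ε i)) := rfl

theorem coe_mulZ : (mulZ M N : Module.End ℂ (Series M N)) = mulZPow M N 1 := rfl

theorem coe_mulZ_inv : (↑(mulZ M N)⁻¹ : Module.End ℂ (Series M N)) = mulZPow M N (-1) := rfl

theorem qpow_half_sq (ℏ x : ℂ) : qpow ℏ (x / 2) ^ 2 = qpow ℏ x := by
  rw [qpow_pow]; congr 1; push_cast; ring

theorem mulZ_commute_h (i : Node) (m : ℤ) (hm : m ≠ 0) :
    Commute (mulZ M N : Module.End ℂ (Series M N)) ((seriesCurrents L R hq).h i m) := by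
  rw [seriesCurrents_h L R hq i m hm]
  exact mulZ_commute_act L R _

theorem isExtremal_typeI_evalRep {α s t : ℂ} {Φ : ℤ → M →ₗ[ℂ] N ⊗[ℂ] V4}
    (hΦ : IsTypeI L R (evalRep ℏ α s t) Φ) :
    ∃ F₁ F₂, IsExtremal (seriesCurrents L R hq) (mulZ M N) (α + 1) 1 (seriesOp (compI Φ 3))
      F₁ F₂ := by
  have h := fun x r => hΦ.component_mul L R x r
  simp only [Fin.sum_univ_four] at h
  have e1 := h (.e 1) 3
  have e2 := h (.e 2) 3
  have f1 := h (.f 1) 3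
  have f2 := h (.f 2) 3
  have k1 := h (.k 1 1) 3
  have k2 := h (.k 1 2) 3
  have f0 := h (.f 0) 3
  have e0 := h (.e 0) 3
  have g1 := h (.e 1) 1
  have l1 := h (.k (-1) 1) 1
  have l2 := h (.k (-1) 2) 1
  clear h
  simp [coproduct, evalRep, par, zdeg, seriesChev, mulZPow_zero, chev, qcomm, seriesAct_G,
    qpow_zero] at e1 e2 f1 f2 k1 k2 f0 e0 g1 l1 l2
  -- `u`, `v`, `w` are the entries of the matrices of `f_2`, `e_0`, `e_1` which connect the
  -- components with each other, and `e₁ + e₂` is the weight of `G₂`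
  refine ⟨_, _, isExtremal_of_typeI (C := seriesCurrents L R hq) (z := mulZ M N)
    (P := seriesParity L R) (G₁ := seriesOp (compI Φ 2)) (G₂ := seriesOp (compI Φ 1))
    (u := t) (v := -t) (w := 1) (e₁ := 1) (e₂ := α)
    (fun _ _ _ => mulZ_commute_act L R _) (mulZ_commute_h L R hq)
    (fun _ _ => mulZ_commute_act L R _) (mulZ_commute_parity L R)
    (parity_commute_act L R _ rfl) (fun _ _ => parity_commute_act L R _ rfl)
    ?_ f1 k1 k2 f0 ?_ ?_ l1 l2 (add_comm _ _) ?_ ?_⟩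
  · rintro (_ | _)
    exacts [e1, e2]
  · rw [neg_add_rev]; exact f2
  · refine e0.trans ?_
    simp [smul_pow, qpow_half_sq, mul_assoc, smul_smul, coe_mulZ, seriesCurrents_K,
      seriesCurrents_X]
  · rw [one_smul]; exact g1
  · simp [qpow_zero]

theorem isExtremal_typeI_evalRepDual {α s t : ℂ} {Φ : ℤ → M →ₗ[ℂ] N ⊗[ℂ] V4}
    (hΦ : IsTypeI L R (evalRepDual ℏ α s t) Φ) :
    ∃ F₁ F₂, IsExtremal (seriesCurrents L R hq) (mulZ M N) (-α) 0 (seriesOp (compI Φ 0))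
      F₁ F₂ := by
  have h := fun x r => hΦ.component_mul L R x r
  simp only [Fin.sum_univ_four] at h
  have e1 := h (.e 1) 0
  have e2 := h (.e 2) 0
  have f1 := h (.f 1) 0
  have f2 := h (.f 2) 0
  have k1 := h (.k 1 1) 0
  have k2 := h (.k 1 2) 0
  have f0 := h (.f 0) 0
  have e0 := h (.e 0) 0
  have g1 := h (.e 1) 2
  have l1 := h (.k (-1) 1) 2
  have l2 := h (.k (-1) 2) 2
  clear h
  simp [coproduct, evalRepDual, par, zdeg, seriesChev, mulZPow_zero, chev, qcomm, seriesAct_G,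
    qpow_zero] at e1 e2 f1 f2 k1 k2 f0 e0 g1 l1 l2
  -- `u`, `v`, `w` are the entries of the matrices of `f_2`, `e_0`, `e_1` which connect the
  -- components with each other, and `e₁ + e₂` is the weight of `G₂`
  refine ⟨_, _, isExtremal_of_typeI (C := seriesCurrents L R hq) (z := mulZ M N)
    (P := seriesParity L R) (G₁ := seriesOp (compI Φ 1)) (G₂ := seriesOp (compI Φ 2))
    (u := -(qpow ℏ α * s)) (v := -(qpow ℏ α * s)) (w := -qpow ℏ (-1)) (e₁ := 1) (e₂ := -(α + 1))
    (fun _ _ _ => mulZ_commute_act L R _) (mulZ_commute_h L R hq)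
    (fun _ _ => mulZ_commute_act L R _) (mulZ_commute_parity L R)
    (parity_commute_act L R _ rfl) (fun _ _ => parity_commute_act L R _ rfl)
    ?_ f1 k1 k2 f0 ?_ ?_ ?_ ?_ (by ring) ?_ ?_⟩
  · rintro (_ | _)
    exacts [e1, e2]
  · rw [neg_neg]; exact f2
  · refine e0.trans ?_
    simp [smul_pow, qpow_half_sq, mul_assoc, smul_smul, coe_mulZ, seriesCurrents_K,
      seriesCurrents_X]
  · exact l1
  · rw [neg_neg]; exact l2
  · exact g1
  · rw [zero_sub]; ring

theorem isExtremal_typeII_evalRep {α s t : ℂ} {Ψ : ℤ → M →ₗ[ℂ] V4 ⊗[ℂ] N}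
    (hΨ : IsTypeII L R (evalRep ℏ α s t) Ψ) :
    ∃ F₁ F₂, IsExtremal (seriesCurrents L R hq).flip (mulZ M N)⁻¹ (-α) 0
      (seriesOp (compII Ψ 0)) F₁ F₂ := by
  have h := fun x r => hΨ.component_mul L R x r
  simp only [Fin.sum_univ_four] at h
  have e1 := h (.e 1) 0
  have e2 := h (.e 2) 0
  have f1 := h (.f 1) 0
  have f2 := h (.f 2) 0
  have k1 := h (.k (-1) 1) 0
  have k2 := h (.k (-1) 2) 0
  have f0 := h (.f 0) 0
  have e0 := h (.e 0) 0
  have g1 := h (.f 1) 2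
  clear h
  simp [coproduct, evalRep, parV, par, zdeg, seriesChev, mulZPow_zero, chev, qcomm, seriesAct_G,
    qpow_zero] at e1 e2 f1 f2 k1 k2 f0 e0 g1
  -- `-u`, `v`, `w` are the entries of the matrices of `e_2`, `f_0`, `f_1` which connect the
  -- components with each other
  refine ⟨_, _, isExtremal_of_typeII (C := seriesCurrents L R hq) (z := mulZ M N)
    (G₁ := seriesOp (compII Ψ 1)) (G₂ := seriesOp (compII Ψ 2)) (u := -s) (v := -s) (w := 1)
    (fun _ _ _ => mulZ_commute_act L R _) (mulZ_commute_h L R hq)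
    (fun _ _ => mulZ_commute_act L R _) ?_ e1 k1 k2 e0 ?_ ?_ ?_ ?_⟩
  · rintro (_ | _)
    exacts [f1, f2]
  · rw [neg_neg, neg_neg]; exact e2
  · refine f0.trans ?_
    simp [smul_pow, qpow_half_sq, mul_assoc, smul_smul, coe_mulZ_inv, seriesCurrents_K,
      seriesCurrents_X]
  · rw [one_smul]; exact g1
  · simp [qpow_zero]

theorem isExtremal_typeII_evalRepDual {α s t : ℂ} {Ψ : ℤ → M →ₗ[ℂ] V4 ⊗[ℂ] N}
    (hΨ : IsTypeII L R (evalRepDual ℏ α s t) Ψ) :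
    ∃ F₁ F₂, IsExtremal (seriesCurrents L R hq).flip (mulZ M N)⁻¹ (α + 1) 1
      (seriesOp (compII Ψ 3)) F₁ F₂ := by
  have h := fun x r => hΨ.component_mul L R x r
  simp only [Fin.sum_univ_four] at h
  have e1 := h (.e 1) 3
  have e2 := h (.e 2) 3
  have f1 := h (.f 1) 3
  have f2 := h (.f 2) 3
  have k1 := h (.k (-1) 1) 3
  have k2 := h (.k (-1) 2) 3
  have f0 := h (.f 0) 3
  have e0 := h (.e 0) 3
  have g1 := h (.f 1) 1
  clear h
  simp [coproduct, evalRepDual, parV, par, zdeg, seriesChev, mulZPow_zero, chev, qcomm,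
    seriesAct_G, qpow_zero] at e1 e2 f1 f2 k1 k2 f0 e0 g1
  -- `-u`, `v`, `w` are the entries of the matrices of `e_2`, `f_0`, `f_1` which connect the
  -- components with each other
  refine ⟨_, _, isExtremal_of_typeII (C := seriesCurrents L R hq) (z := mulZ M N)
    (G₁ := seriesOp (compII Ψ 2)) (G₂ := seriesOp (compII Ψ 1))
    (u := qpow ℏ (-α - 1) * t) (v := -(qpow ℏ (-α - 1) * t)) (w := -qpow ℏ 1)
    (fun _ _ _ => mulZ_commute_act L R _) (mulZ_commute_h L R hq)
    (fun _ _ => mulZ_commute_act L R _) ?_ e1 k1 ?_ ?_ ?_ ?_ ?_ ?_⟩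
  · rintro (_ | _)
    exacts [f1, f2]
  · exact k2
  · exact e0
  · rw [neg_add_rev]; exact e2
  · refine f0.trans ?_
    simp [smul_pow, qpow_half_sq, mul_assoc, smul_smul, coe_mulZ_inv, seriesCurrents_K,
      seriesCurrents_X]
  · exact g1
  · ring

end Evaluation

end QAffSl21

end

theorem proposition3 {M N : Type*} [AddCommGroup M] [Module ℂ M] [AddCommGroup N] [Module ℂ N]
    (ℏ α k s t : ℂ)
    (hq : QAffSl21.qpow ℏ 1 ≠ QAffSl21.qpow ℏ (-1))
    (hα : α ≠ 0) (hα' : α ≠ -1) (hk : k ≠ 0) (hk' : k ≠ -1)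
    (hs : s ^ 2 = QAffSl21.qnum ℏ α) (ht : t ^ 2 = QAffSl21.qnum ℏ (α + 1))
    (L : QAffSl21.LevelModule ℏ k M) (R : QAffSl21.LevelModule ℏ k N) :
    (∀ Φ : ℤ → M →ₗ[ℂ] TensorProduct ℂ N QAffSl21.V4,
      QAffSl21.IsTypeI L R (QAffSl21.evalRep ℏ α s t) Φ → ∀ i : QAffSl21.Node,
        QAffSl21.CommutesWithX L R (QAffSl21.compI Φ 3) 1 i ∧
        QAffSl21.HasWeight L R (QAffSl21.compI Φ 3) i (-(α + 1) * QAffSl21.deltaTwo i) ∧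
        ∀ (n : ℤ) (hn : 0 < n),
          QAffSl21.HCommutator L R (QAffSl21.compI Φ 3) i n hn.ne'
            (-QAffSl21.deltaTwo i * QAffSl21.qpow ℏ ((1 + 3 / 2 * k) * n) *
              (QAffSl21.qnum ℏ ((α + 1) * n) / n)) ∧
          QAffSl21.HCommutator L R (QAffSl21.compI Φ 3) i (-n) (neg_ne_zero.mpr hn.ne')
            (-QAffSl21.deltaTwo i * QAffSl21.qpow ℏ (-(1 + 1 / 2 * k) * n) *
              (QAffSl21.qnum ℏ ((α + 1) * n) / n))) ∧
    (∀ Φ : ℤ → M →ₗ[ℂ] TensorProduct ℂ N QAffSl21.V4,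
      QAffSl21.IsTypeI L R (QAffSl21.evalRepDual ℏ α s t) Φ → ∀ i : QAffSl21.Node,
        QAffSl21.CommutesWithX L R (QAffSl21.compI Φ 0) 1 i ∧
        QAffSl21.HasWeight L R (QAffSl21.compI Φ 0) i (α * QAffSl21.deltaTwo i) ∧
        ∀ (n : ℤ) (hn : 0 < n),
          QAffSl21.HCommutator L R (QAffSl21.compI Φ 0) i n hn.ne'
            (QAffSl21.deltaTwo i * QAffSl21.qpow ℏ (3 / 2 * k * n) *
              (QAffSl21.qnum ℏ (α * n) / n)) ∧
          QAffSl21.HCommutator L R (QAffSl21.compI Φ 0) i (-n) (neg_ne_zero.mpr hn.ne')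
            (QAffSl21.deltaTwo i * QAffSl21.qpow ℏ (-(1 / 2) * k * n) *
              (QAffSl21.qnum ℏ (α * n) / n))) ∧
    (∀ Ψ : ℤ → M →ₗ[ℂ] TensorProduct ℂ QAffSl21.V4 N,
      QAffSl21.IsTypeII L R (QAffSl21.evalRep ℏ α s t) Ψ → ∀ i : QAffSl21.Node,
        QAffSl21.CommutesWithX L R (QAffSl21.compII Ψ 0) (-1) i ∧
        QAffSl21.HasWeight L R (QAffSl21.compII Ψ 0) i (-α * QAffSl21.deltaTwo i) ∧
        ∀ (n : ℤ) (hn : 0 < n),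
          QAffSl21.HCommutator L R (QAffSl21.compII Ψ 0) i n hn.ne'
            (-QAffSl21.deltaTwo i * QAffSl21.qpow ℏ (1 / 2 * k * n) *
              (QAffSl21.qnum ℏ (α * n) / n)) ∧
          QAffSl21.HCommutator L R (QAffSl21.compII Ψ 0) i (-n) (neg_ne_zero.mpr hn.ne')
            (-QAffSl21.deltaTwo i * QAffSl21.qpow ℏ (-(3 / 2) * k * n) *
              (QAffSl21.qnum ℏ (α * n) / n))) ∧
    (∀ Ψ : ℤ → M →ₗ[ℂ] TensorProduct ℂ QAffSl21.V4 N,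
      QAffSl21.IsTypeII L R (QAffSl21.evalRepDual ℏ α s t) Ψ → ∀ i : QAffSl21.Node,
        QAffSl21.CommutesWithX L R (QAffSl21.compII Ψ 3) (-1) i ∧
        QAffSl21.HasWeight L R (QAffSl21.compII Ψ 3) i ((α + 1) * QAffSl21.deltaTwo i) ∧
        ∀ (n : ℤ) (hn : 0 < n),
          QAffSl21.HCommutator L R (QAffSl21.compII Ψ 3) i n hn.ne'
            (QAffSl21.deltaTwo i * QAffSl21.qpow ℏ ((1 / 2 * k - 1) * n) *
              (QAffSl21.qnum ℏ ((α + 1) * n) / n)) ∧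
          QAffSl21.HCommutator L R (QAffSl21.compII Ψ 3) i (-n) (neg_ne_zero.mpr hn.ne')
            (QAffSl21.deltaTwo i * QAffSl21.qpow ℏ ((-(3 / 2) * k + 1) * n) *
              (QAffSl21.qnum ℏ ((α + 1) * n) / n))) := by
  have hneg : ∀ x, QAffSl21.qnum ℏ (-x) = -QAffSl21.qnum ℏ x := fun x => by
    rw [QAffSl21.qnum, QAffSl21.qnum, neg_neg]; ring
  refine ⟨fun Φ hΦ i => ?_, fun Φ hΦ i => ?_, fun Ψ hΨ i => ?_, fun Ψ hΨ i => ?_⟩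
  · obtain ⟨F₁, F₂, hE⟩ := QAffSl21.isExtremal_typeI_evalRep L R hq hΦ
    exact QAffSl21.typeI_properties L R hq hE i
  · obtain ⟨F₁, F₂, hE⟩ := QAffSl21.isExtremal_typeI_evalRepDual L R hq hΦ
    have h := QAffSl21.typeI_properties L R hq hE i
    simp only [neg_mul, hneg, neg_div, mul_neg, neg_neg, zero_add] at h ⊢
    exact h
  · obtain ⟨F₁, F₂, hE⟩ := QAffSl21.isExtremal_typeII_evalRep L R hq hΨ
    have h := QAffSl21.typeII_properties L R hq hE i
    simp only [neg_mul, hneg, neg_div, mul_neg, sub_zero, add_zero] at h ⊢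
    exact h
  · obtain ⟨F₁, F₂, hE⟩ := QAffSl21.isExtremal_typeII_evalRepDual L R hq hΨ
    exact QAffSl21.typeII_properties L R hq hE i
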